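/- Let $p_1,p_2\in\mathbb N$ be coprime weights, let $h\in\mathbb C[x,y]$ be quasi-homogeneous of degree $\delta>0$ for these weights, and suppose that $dh$ has no zero other than $0$ in some neighbourhood of $0\in\mathbb C^2$ (so $h$ has an isolated singularity at $0$, or is regular there). Write $\widehat{\mathcal O}=\mathbb C[[x,y]]$, $S=\{h=0\}$, and $$R=p_1x\partial_x+p_2y\partial_y,\quad X_0=\tfrac1\delta(h_y\partial_x-h_x\partial_y),\quad \omega_0=\tfrac1\delta\frac{dh}{h},\quad \omega_R=\frac{p_1x\,dy-p_2y\,dx}{h}.$$ Let $J_0=(h_x,h_y)\subset\widehat{\mathcal O}$, $\mu=\dim_{\mathbb C}\widehat{\mathcal O}/J_0$, and let $\mathbb C[[h]]\subset\widehat{\mathcal O}$ be the ring of formal power series in $h$. Let $\widehat\chi(\log S)$ be the module of formal vector fields $X$ with $X(h)\in(h)$, and $\widehat\Omega^q(\log S)$ the module of formal meromorphic $q$-forms $\omega$ such that $h\omega$ and $h\,d\omega$ have no pole. Let $\widehat H^1_{DR}(\log S)$ be the first cohomology of the relative complex $\widehat\Omega^{\bullet}(\log S)/\bigl(\omega_0\wedge\widehat\Omega^{\bullet-1}(\log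 S)\bigr)$ with differential $d$, let $\mathrm{Coker}(X_0)=\widehat{\mathcal O}/X_0(\widehat{\mathcal O})$, and let $$G^1_K=\widehat\chi(\log S)\big/\bigl([X_0,\widehat\chi(\log S)]+\widehat{\mathcal O}X_0\bigr).$$ All of these are $\mathbb C[[h]]$-modules. Then: 1. Every form in $\widehat\Omega^1(\log S)$ is relatively closed (that is, $d\omega\in\omega_0\wedge\widehat\Omega^1(\log S)$), so that $\widehat H^1_{DR}(\log S)=\widehat\Omega^1(\log S)/\{df+g\,\omega_0 : f,g\in\widehat{\mathcal O}\}$. 2. The map $X\mapsto X^\sharp=i_X\bigl(\tfrac{dx\wedge dy}{h}\bigr)$ induces an isomorphism of $\mathbb C[[h]]$-modules $G^1_K\simeq\widehat H^1_{DR}(\log S)$. 3. The map $b\mapsto b\,\omega_R$ induces an isomorphism of $\mathbb C[[h]]$-modules $\mathrm{Coker}(X_0)\simeq\widehat H^1_{DR}(\log S)$; that is, $\widehat H^1_{DR}(\log S)=\mathrm{Coker}(X_0)\cdot\omega_R$. 4. $\mu$ is finite and $\widehat H^1_{DR}(\log S)$ is a free $\mathbb C[[h]]$-module of rank $\mu$.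 If $a_1,\dots,a_\mu\in\widehat{\mathcal O}$ represent a $\mathbb C$-basis of $\widehat{\mathcal O}/J_0$, then the classes of $a_1\omega_R,\dots,a_\mu\omega_R$ form a $\mathbb C[[h]]$-basis of $\widehat H^1_{DR}(\log S)$. -/

import Mathlib

/-- The subquotient `N / (N ∩ P)` of a module, for submodules `N` and `P`. -/
def Subquotient {A M : Type*} [CommRing A] [AddCommGroup M] [Module A M] (N P : Submodule A M) :
    Type _ := N ⧸ P.submoduleOf N

namespace Subquotient

variable {A M : Type*} [CommRing A] [AddCommGroup M] [Module A M] (N P : Submodule A M)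

instance : AddCommGroup (Subquotient N P) := inferInstanceAs (AddCommGroup (N ⧸ P.submoduleOf N))

instance : Module A (Subquotient N P) := inferInstanceAs (Module A (N ⧸ P.submoduleOf N))

/-- The class in `N / (N ∩ P)` of an element of `N`. -/
def mk : N →ₗ[A] Subquotient N P := (P.submoduleOf N).mkQ

end Subquotient

/-! Formal functions, vector fields and differential forms in two variables. The variables `x`, `y`
are the variables of index `0`, `1`. -/

/-- The ring `ℂ[[x, y]]`. -/
abbrev FormalFn : Type := MvPowerSeries (Fin 2) ℂ

instance : IsDomain FormalFn := NoZeroDivisors.to_isDomain FormalFn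

/-- The fraction field of `ℂ[[x, y]]`. -/
abbrev FormalMero : Type := FractionRing FormalFn

/-- Formal vector fields `X 0 ∂x + X 1 ∂y`. -/
abbrev FormalField : Type := Fin 2 → FormalFn

/-- Formal meromorphic 1-forms `ω 0 dx + ω 1 dy`. -/
abbrev MeroForm : Type := Fin 2 → FormalMero

instance : IsLocalizedModule (nonZeroDivisors FormalFn)
    (KaehlerDifferential.map ℂ ℂ FormalFn FormalMero) :=
  KaehlerDifferential.isLocalizedModule_map ℂ FormalFn FormalMero (nonZeroDivisors FormalFn)

/-- A derivation of `ℂ[[x, y]]` as a linear map on the Kähler differentials of the fraction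
field. -/
noncomputable def extendLin (D : Derivation ℂ FormalFn FormalFn) :
    KaehlerDifferential ℂ FormalMero →ₗ[FormalMero] FormalMero :=
  LinearMap.extendScalarsOfIsLocalization (nonZeroDivisors FormalFn) FormalMero
    (IsLocalizedModule.lift (nonZeroDivisors FormalFn)
      (KaehlerDifferential.map ℂ ℂ FormalFn FormalMero)
      ((Algebra.linearMap FormalFn FormalMero).comp D.liftKaehlerDifferential)
      (IsLocalizedModule.map_units (Algebra.linearMap FormalFn FormalMero)))

/-- The unique extension of a derivation of `ℂ[[x, y]]` to the fraction field. -/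
noncomputable def extendDerivation (D : Derivation ℂ FormalFn FormalFn) :
    Derivation ℂ FormalMero FormalMero :=
  (extendLin D).compDer (KaehlerDifferential.D ℂ FormalMero)

theorem extendDerivation_algebraMap (D : Derivation ℂ FormalFn FormalFn) (f : FormalFn) :
    extendDerivation D (algebraMap FormalFn FormalMero f) =
      algebraMap FormalFn FormalMero (D f) := by
  have h1 : KaehlerDifferential.D ℂ FormalMero (algebraMap FormalFn FormalMero f)
      = KaehlerDifferential.map ℂ ℂ FormalFn FormalMero (KaehlerDifferential.D ℂ FormalFn f) := by
    simp
  change extendLin D (KaehlerDifferential.D ℂ FormalMero _) = _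
  rw [h1, extendLin, LinearMap.extendScalarsOfIsLocalization_apply', IsLocalizedModule.lift_apply]
  simp

/-- The partial derivatives `∂x`, `∂y` on formal meromorphic functions. -/
noncomputable def merD (i : Fin 2) : Derivation ℂ FormalMero FormalMero :=
  extendDerivation (MvPowerSeries.pderiv ℂ i)

@[simp] theorem merD_algebraMap (i : Fin 2) (f : FormalFn) :
    merD i (algebraMap FormalFn FormalMero f) =
      algebraMap FormalFn FormalMero (MvPowerSeries.pderiv ℂ i f) :=
  extendDerivation_algebraMap _ f

/-- The derivation `f ↦ X(f)` of `ℂ[[x, y]]` attached to a formal vector field `X`. -/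
noncomputable def FormalField.der (X : FormalField) : Derivation ℂ FormalFn FormalFn :=
  X 0 • MvPowerSeries.pderiv ℂ 0 + X 1 • MvPowerSeries.pderiv ℂ 1

theorem FormalField.der_apply (X : FormalField) (f : FormalFn) :
    X.der f = X 0 * MvPowerSeries.pderiv ℂ 0 f + X 1 * MvPowerSeries.pderiv ℂ 1 f := rfl

/-- The Lie bracket `[X, Y]`. -/
noncomputable def FormalField.bracket (X Y : FormalField) : FormalField :=
  fun i => X.der (Y i) - Y.der (X i)

theorem MeroForm.smul_apply (c : FormalFn) (ω : MeroForm) (i : Fin 2) :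
    (c • ω) i = algebraMap FormalFn FormalMero c * ω i := Algebra.smul_def c (ω i)

/-- The differential `df` of a meromorphic function. -/
noncomputable def merDiff (f : FormalMero) : MeroForm := fun i => merD i f

/-- The differential of a meromorphic 1-form, as the coefficient of `dx ∧ dy`. -/
noncomputable def MeroForm.diff (ω : MeroForm) : FormalMero := merD 0 (ω 1) - merD 1 (ω 0)

/-- The wedge product of two meromorphic 1-forms, as the coefficient of `dx ∧ dy`. -/
noncomputable def MeroForm.wedge (ω η : MeroForm) : FormalMero := ω 0 * η 1 - ω 1 * η 0

/-- The function (or 2-form) `z` has no pole. -/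
def IsHolo (z : FormalMero) : Prop := ∃ f : FormalFn, algebraMap FormalFn FormalMero f = z

/-- The module `χ̂(log S)` of formal vector fields that are logarithmic for `S = {s = 0}`:
`X(s)` belongs to the ideal `(s)`. -/
noncomputable def logFields (s : FormalFn) : Submodule FormalFn FormalField where
  carrier := {X | s ∣ X.der s}
  zero_mem' := by simp [FormalField.der_apply]
  add_mem' := by
    intro X Y hX hY
    have : FormalField.der (X + Y) s = FormalField.der X s + FormalField.der Y s := by
      simp only [FormalField.der_apply, Pi.add_apply]; ring
    simpa only [Set.mem_ofPred_eq, this] using dvd_add hX hY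
  smul_mem' := by
    intro c X hX
    have : FormalField.der (c • X) s = c * FormalField.der X s := by
      simp only [FormalField.der_apply, Pi.smul_apply, smul_eq_mul]; ring
    simpa only [Set.mem_ofPred_eq, this] using dvd_mul_of_dvd_right hX c

/-- The module `Ω̂¹(log S)` of formal logarithmic 1-forms for `S = {s = 0}`: meromorphic 1-forms
`ω` such that `s ω` and `s dω` have no pole. -/
noncomputable def logForms (s : FormalFn) : Submodule FormalFn MeroForm where
  carrier := {ω | (∀ i, IsHolo (s • ω i)) ∧ IsHolo (s • ω.diff)}
  zero_mem' := ⟨fun i => ⟨0, by simp⟩, ⟨0, by simp [MeroForm.diff]⟩⟩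
  add_mem' := by
    rintro ω η ⟨h1, u, hu⟩ ⟨h2, v, hv⟩
    refine ⟨fun i => ?_, u + v, ?_⟩
    · obtain ⟨a, ha⟩ := h1 i
      obtain ⟨b, hb⟩ := h2 i
      exact ⟨a + b, by rw [map_add, ha, hb, Pi.add_apply, smul_add]⟩
    · rw [map_add, hu, hv, ← smul_add]
      congr 1
      simp only [MeroForm.diff, Pi.add_apply, map_add]; ring
  smul_mem' := by
    rintro c ω ⟨h1, u, hu⟩
    obtain ⟨a, ha⟩ := h1 0
    obtain ⟨b, hb⟩ := h1 1
    refine ⟨fun i => ?_, c * u + (MvPowerSeries.pderiv ℂ 0 c * b - MvPowerSeries.pderiv ℂ 1 c * a), ?_⟩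
    · obtain ⟨e, he⟩ := h1 i
      exact ⟨c * e, by rw [map_mul, he, Pi.smul_apply, smul_comm s c, Algebra.smul_def c]⟩
    · simp only [map_add, map_sub, map_mul, hu, ha, hb, MeroForm.diff, MeroForm.smul_apply,
        Derivation.leibniz, merD_algebraMap, smul_eq_mul]
      simp only [Algebra.smul_def s]
      ring

/-- The isomorphism `X ↦ X^♯ = i_X Ω` with `Ω = dx ∧ dy / s`, from vector fields to 1-forms. -/
noncomputable def sharp (s : FormalFn) (X : FormalField) : MeroForm :=
  ![-(algebraMap FormalFn FormalMero (X 1) / algebraMap FormalFn FormalMero s),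
    algebraMap FormalFn FormalMero (X 0) / algebraMap FormalFn FormalMero s]

/-- A polynomial `h` in two variables, quasi-homogeneous of degree `δ > 0` for coprime weights
`p = (p₁, p₂)`, whose differential has no zero other than `0` near `0` in `ℂ²`. The weights are
natural numbers; `h` is also allowed to be regular at `0`. -/
structure QHSingularity where
  p : Fin 2 → ℕ
  coprime_p : Nat.Coprime (p 0) (p 1)
  δ : ℕ
  δ_pos : 0 < δ
  h : MvPolynomial (Fin 2) ℂ
  quasiHomogeneous : MvPolynomial.IsWeightedHomogeneous p h δ
  isolated : ∀ᶠ z in nhdsWithin (0 : Fin 2 → ℂ) {0}ᶜ,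
    ¬ (MvPolynomial.eval z (MvPolynomial.pderiv 0 h) = 0 ∧
        MvPolynomial.eval z (MvPolynomial.pderiv 1 h) = 0)

namespace QHSingularity

variable (D : QHSingularity)

/-- `h` as a formal power series; `S = {h = 0}` is the separatrix. -/
noncomputable def hs : FormalFn := (D.h : FormalFn)

/-- The weighted radial vector field `R = p₁ x ∂x + p₂ y ∂y`. -/
noncomputable def R : FormalField := fun i => (D.p i : FormalFn) * MvPowerSeries.X i

/-- The Hamiltonian vector field `X₀ = δ⁻¹ (h_y ∂x - h_x ∂y)`. -/
noncomputable def X₀ : FormalField :=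
  ![(D.δ : ℂ)⁻¹ • MvPowerSeries.pderiv ℂ 1 D.hs, -((D.δ : ℂ)⁻¹ • MvPowerSeries.pderiv ℂ 0 D.hs)]

/-- The form `ω₀ = δ⁻¹ dh / h`. -/
noncomputable def ω₀ : MeroForm := fun i =>
  (D.δ : FormalMero)⁻¹ * (merDiff (algebraMap FormalFn FormalMero D.hs) i /
    algebraMap FormalFn FormalMero D.hs)

/-- The form `ω_R = R^♯ = (p₁ x dy - p₂ y dx) / h`. -/
noncomputable def ωR : MeroForm := sharp D.hs D.R

/-- The ideal `J₀` generated by the components of `X₀`. -/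
noncomputable def J₀ : Ideal FormalFn := Ideal.span {D.X₀ 0, D.X₀ 1}

/-- The Milnor number `μ = dim ℂ[[x, y]] / J₀`. -/
noncomputable def μ : ℕ := Module.finrank ℂ (FormalFn ⧸ D.J₀)

theorem constantCoeff_hs : MvPowerSeries.constantCoeff D.hs = 0 := by
  have := D.quasiHomogeneous.coeff_eq_zero 0 (by simpa using D.δ_pos.ne)
  rw [hs, ← MvPowerSeries.coeff_zero_eq_constantCoeff_apply, MvPolynomial.coeff_coe, this]

theorem hasSubst_hs : PowerSeries.HasSubst D.hs :=
  PowerSeries.HasSubst.of_constantCoeff_zero D.constantCoeff_hs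

/-- The ring `ℂ[[h]]` of the formal power series in `h`, as a subring of `ℂ[[x, y]]`. -/
noncomputable def Ch : Subalgebra ℂ FormalFn :=
  (PowerSeries.substAlgHom (R := ℂ) D.hasSubst_hs).range

theorem X₀_hs : D.X₀.der D.hs = 0 := by
  simp only [FormalField.der_apply, X₀, Matrix.cons_val_zero, Matrix.cons_val_one]
  simp only [MvPowerSeries.smul_eq_C_mul]
  ring

theorem X₀_mem_Ch {c : FormalFn} (hc : c ∈ D.Ch) : D.X₀.der c = 0 := by
  obtain ⟨l, rfl⟩ := hc
  have key : ∀ n : ℕ, ∀ l : PowerSeries ℂ,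
      D.hs ^ n ∣ D.X₀.der (PowerSeries.substAlgHom (R := ℂ) D.hasSubst_hs l) := by
    intro n
    induction n with
    | zero => simp
    | succ n ih =>
      intro l
      obtain ⟨e, he⟩ := ih (PowerSeries.mk fun i => PowerSeries.coeff (i + 1) l)
      refine ⟨e, ?_⟩
      conv_lhs => rw [PowerSeries.eq_X_mul_shift_add_const l]
      have hC : PowerSeries.substAlgHom (R := ℂ) D.hasSubst_hs
          (PowerSeries.C (PowerSeries.constantCoeff l)) =
          algebraMap ℂ FormalFn (PowerSeries.constantCoeff l) :=
        AlgHom.commutes (PowerSeries.substAlgHom (R := ℂ) D.hasSubst_hs) _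
      rw [map_add, map_mul, PowerSeries.substAlgHom_X, hC, map_add, Derivation.map_algebraMap,
        Derivation.leibniz, D.X₀_hs, he]
      simp only [smul_eq_mul]
      ring
  refine MvPowerSeries.order_eq_top_iff.mp (ENat.eq_top_iff_forall_ge.mpr fun n => ?_)
  obtain ⟨e, he⟩ := key n l
  refine le_trans ?_ (show _ ≤ (D.X₀.der _).order from he ▸ MvPowerSeries.le_order_mul)
  exact le_add_right (MvPowerSeries.le_order_pow_of_constantCoeff_eq_zero n D.constantCoeff_hs)

theorem Ch_smul_apply (c : D.Ch) (ω : MeroForm) (i : Fin 2) :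
    (c • ω) i = algebraMap FormalFn FormalMero c * ω i := Algebra.smul_def (c : FormalFn) (ω i)

/-- The derivation `X₀` of `ℂ[[x, y]]`, as a `ℂ[[h]]`-linear map. -/
noncomputable def X₀Lin : FormalFn →ₗ[D.Ch] FormalFn where
  toFun f := D.X₀.der f
  map_add' f g := map_add _ f g
  map_smul' := by
    rintro ⟨c, hc⟩ f
    simp [Subalgebra.smul_def, D.X₀_mem_Ch hc]

/-- `Coker(X₀) = ℂ[[x, y]] / Im(X₀)`. -/
abbrev CokerX₀ : Type := FormalFn ⧸ LinearMap.range D.X₀Lin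

/-- The logarithmic vector fields for `S`, as a `ℂ[[h]]`-module. -/
noncomputable def χlog : Submodule D.Ch FormalField := (logFields D.hs).restrictScalars D.Ch

/-- `A¹ = Im(ad X₀) + ℂ[[x, y]] X₀`, with `ad X₀ = [X₀, ·]` acting on the logarithmic vector
fields. -/
noncomputable def A1 : Submodule D.Ch FormalField where
  carrier := {Y | ∃ Z ∈ logFields D.hs, ∃ a : FormalFn, Y = D.X₀.bracket Z + a • D.X₀}
  zero_mem' := ⟨0, zero_mem _, 0, by
    ext1 i; simp [FormalField.bracket, FormalField.der_apply]⟩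
  add_mem' := by
    rintro _ _ ⟨Z, hZ, a, rfl⟩ ⟨W, hW, b, rfl⟩
    refine ⟨Z + W, add_mem hZ hW, a + b, ?_⟩
    ext1 i
    simp only [FormalField.bracket, FormalField.der_apply, Pi.add_apply, Pi.smul_apply, map_add,
      smul_eq_mul]
    ring
  smul_mem' := by
    rintro ⟨c, hc⟩ _ ⟨Z, hZ, a, rfl⟩
    refine ⟨c • Z, Submodule.smul_mem _ _ hZ, c * a, ?_⟩
    have h0 := D.X₀_mem_Ch hc
    rw [FormalField.der_apply] at h0
    ext1 i
    simp only [Subalgebra.smul_def, FormalField.bracket, FormalField.der_apply, Pi.add_apply,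
      Pi.smul_apply, smul_eq_mul, Derivation.leibniz]
    linear_combination (-(Z i)) * h0

/-- `G¹ = χ̂(log S) / A¹`, the module of prenormal forms of foliations. -/
abbrev G1 : Type := Subquotient D.χlog D.A1

theorem hs_ne_zero : D.hs ≠ 0 := by
  intro h0
  have hz : D.h = 0 := MvPolynomial.coe_injective (σ := Fin 2) (R := ℂ) (by simpa [hs] using h0)
  have h1 := D.isolated
  simp only [hz, map_zero, and_self, not_true_eq_false, Filter.eventually_false_iff_eq_bot] at h1
  exact (inferInstance : (nhdsWithin (0 : Fin 2 → ℂ) {0}ᶜ).NeBot).ne h1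

theorem euler : D.R.der D.hs = (D.δ : FormalFn) * D.hs := by
  have h1 := congrArg (MvPolynomial.coeToMvPowerSeries.ringHom (σ := Fin 2) (R := ℂ))
    D.quasiHomogeneous.sum_weight_X_mul_pderiv
  simp only [Fin.sum_univ_two, nsmul_eq_mul, map_add, map_mul, map_natCast,
    MvPolynomial.coeToMvPowerSeries.ringHom_apply, MvPolynomial.coe_X] at h1
  simp only [FormalField.der_apply, R, hs, MvPowerSeries.pderiv_coe]
  linear_combination h1

/-- `df = R(f) ω₀ - X₀(f) ω_R`. -/
theorem merDiff_eq (f : FormalFn) :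
    merDiff (algebraMap FormalFn FormalMero f) = D.R.der f • D.ω₀ - D.X₀.der f • D.ωR := by
  have he := congrArg (algebraMap FormalFn FormalMero) D.euler
  have hδ : (D.δ : FormalMero) ≠ 0 := by
    rw [← map_natCast (algebraMap ℂ FormalMero)]
    exact (map_ne_zero _).mpr (Nat.cast_ne_zero.mpr D.δ_pos.ne')
  have hh : algebraMap FormalFn FormalMero D.hs ≠ 0 := by
    simpa using D.hs_ne_zero
  have hc : ∀ g : FormalFn, algebraMap FormalFn FormalMero ((D.δ : ℂ)⁻¹ • g) =
      (D.δ : FormalMero)⁻¹ * algebraMap FormalFn FormalMero g := by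
    intro g
    rw [Algebra.smul_def, map_mul, ← IsScalarTower.algebraMap_apply, map_inv₀, map_natCast]
  simp only [FormalField.der_apply, R, map_add, map_mul, map_natCast] at he
  ext1 i
  fin_cases i <;>
  · simp only [merDiff, merD_algebraMap, ω₀, ωR, sharp, FormalField.der_apply, X₀, R, Pi.sub_apply,
      MeroForm.smul_apply, map_add, map_mul, map_natCast, map_neg, hc,
      Matrix.cons_val_zero, Matrix.cons_val_one, Fin.zero_eta, Fin.mk_one]
    field_simp
    first
      | linear_combination -(algebraMap FormalFn FormalMero (MvPowerSeries.pderiv ℂ 0 f)) * he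
      | linear_combination -(algebraMap FormalFn FormalMero (MvPowerSeries.pderiv ℂ 1 f)) * he

/-- The relative 1-cocycles `{ω ∈ Ω̂¹(log S) : dω ∈ ω₀ ∧ Ω̂¹(log S)}`: the logarithmic 1-forms that
are closed in the relative complex `Ω̂^•(log S) / (ω₀ ∧ Ω̂^{•-1}(log S))`. -/
noncomputable def Z1 : Submodule D.Ch MeroForm where
  carrier := {ω | ω ∈ logForms D.hs ∧ ∃ η ∈ logForms D.hs, ω.diff = D.ω₀.wedge η}
  zero_mem' := ⟨zero_mem _, 0, zero_mem _, by simp [MeroForm.diff, MeroForm.wedge]⟩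
  add_mem' := by
    rintro ω ω' ⟨h, η, hη, e⟩ ⟨h', η', hη', e'⟩
    refine ⟨add_mem h h', η + η', add_mem hη hη', ?_⟩
    simp only [MeroForm.diff, MeroForm.wedge, Pi.add_apply, map_add] at *
    linear_combination e + e'
  smul_mem' := by
    rintro ⟨c, hc⟩ ω ⟨h, η, hη, e⟩
    refine ⟨Submodule.smul_mem _ c h, c • η + D.R.der c • ω,
      add_mem (Submodule.smul_mem _ _ hη) (Submodule.smul_mem _ _ h), ?_⟩
    have hd := D.merDiff_eq c
    rw [D.X₀_mem_Ch hc, zero_smul, sub_zero] at hd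
    have h0 := congrFun hd 0
    have h1 := congrFun hd 1
    simp only [merDiff, merD_algebraMap, MeroForm.smul_apply] at h0 h1
    simp only [MeroForm.diff, MeroForm.wedge, Pi.add_apply, MeroForm.smul_apply, Ch_smul_apply,
      Derivation.leibniz, merD_algebraMap, smul_eq_mul] at *
    rw [h0, h1]
    linear_combination (algebraMap FormalFn FormalMero c) * e

/-- The relative 1-coboundaries `B¹ = {df + g ω₀ : f, g ∈ ℂ[[x, y]]}`. -/
noncomputable def B1 : Submodule D.Ch MeroForm where
  carrier := {α | ∃ f g : FormalFn, α = merDiff (algebraMap FormalFn FormalMero f) + g • D.ω₀}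
  zero_mem' := ⟨0, 0, by ext1 i; simp [merDiff]⟩
  add_mem' := by
    rintro _ _ ⟨f, g, rfl⟩ ⟨f', g', rfl⟩
    refine ⟨f + f', g + g', ?_⟩
    ext1 i
    simp only [merDiff, Pi.add_apply, map_add, add_smul]
    ring
  smul_mem' := by
    rintro ⟨c, hc⟩ _ ⟨f, g, rfl⟩
    refine ⟨c * f, c * g - f * D.R.der c, ?_⟩
    have hd := D.merDiff_eq c
    rw [D.X₀_mem_Ch hc, zero_smul, sub_zero] at hd
    ext1 i
    have hi := congrFun hd i
    simp only [merDiff, merD_algebraMap, MeroForm.smul_apply] at hi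
    simp only [merDiff, Pi.add_apply, MeroForm.smul_apply, Ch_smul_apply,
      Derivation.leibniz, merD_algebraMap, smul_eq_mul, map_mul, map_sub]
    rw [hi]
    ring

/-- The relative logarithmic cohomology `Ĥ¹_DR(log S)`. -/
abbrev H1 : Type := Subquotient D.Z1 D.B1

end QHSingularity

/-! The geometric input is that `J₀` contains powers of `x` and of `y`, hence has finite colength.
For positive weights the critical set of `h` is stable under the contracting action `t · z = (t ^ pᵢ
zᵢ)`, so an isolated critical point is the only one in the plane, and the Nullstellensatz applies.
If one weight is `0`, coprimality makes the other `1`, and `h` is explicit enough to treat by hand.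
It follows that the components of `X₀` have only trivial syzygies (`exists_eq_of_syzygy`).

Euler's identity says that `h` is the determinant of `X₀` and `R` (`hs_eq`). With the syzygies it
makes the logarithmic fields the combinations `a X₀ + b R`, so that logarithmic forms are the `a ω₀
+ b ω_R`. Since `df = R(f) ω₀ - X₀(f) ω_R` and `[X₀, R]` is a multiple of `X₀`, such a form is a
coboundary, and such a field lies in `A1`, exactly when `b` is in the image of `X₀`. This yields
both isomorphisms.

Freeness of `Coker(X₀)` rests on two facts: `J₀ = Im X₀ + (h)` (`exists_of_mem_J₀`), so that
`Coker(X₀)` modulo `h` is the Milnor algebra, and the absence of `h`-torsion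
(`exists_X₀_der_eq_of_hs_mul`). Both come from Cartan's formula for the Lie derivative along `R`,
which acts diagonally on monomials. An `h`-adic Nakayama argument with explicit convergent sums then
lifts a basis. -/

open Filter Topology

namespace Subquotient

variable {A M : Type*} [CommRing A] [AddCommGroup M] [Module A M] (N P : Submodule A M)

theorem mk_eq_zero_iff (x : N) : Subquotient.mk N P x = 0 ↔ x.1 ∈ P :=
  Submodule.Quotient.mk_eq_zero _

theorem mk_surjective : Function.Surjective (Subquotient.mk N P) :=
  Submodule.mkQ_surjective _

end Subquotient

/-! ### Power series in two variables: truncation, syzygies, sums over powers of `h` -/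

theorem coeff_X_mul_pderiv (i : Fin 2) (f : FormalFn) (d : Fin 2 →₀ ℕ) :
    MvPowerSeries.coeff d (MvPowerSeries.X i * MvPowerSeries.pderiv ℂ i f) =
      d i * MvPowerSeries.coeff d f := by
  by_cases hd : d i = 0
  · rw [hd, Nat.cast_zero, zero_mul]
    exact MvPowerSeries.X_dvd_iff.mp (dvd_mul_right _ _) d hd
  · obtain ⟨e, rfl⟩ : ∃ e, d = Finsupp.single i 1 + e :=
      exists_add_of_le (by simpa [Finsupp.single_le_iff] using Nat.one_le_iff_ne_zero.mpr hd)
    rw [MvPowerSeries.X, MvPowerSeries.coeff_add_monomial_mul, MvPowerSeries.coeff_pderiv,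
      add_comm e]
    simp
    ring

theorem pderiv_pderiv_comm (i j : Fin 2) (f : FormalFn) :
    MvPowerSeries.pderiv ℂ i (MvPowerSeries.pderiv ℂ j f) =
      MvPowerSeries.pderiv ℂ j (MvPowerSeries.pderiv ℂ i f) := by
  rcases eq_or_ne i j with rfl | hij
  · rfl
  ext d
  simp only [MvPowerSeries.coeff_pderiv, Finsupp.add_apply, Finsupp.single_apply, hij, hij.symm,
    if_false, add_zero, add_right_comm d (Finsupp.single i 1)]
  ring

/-- The monomials `x ^ i * y ^ j` with `i, j < N` span a complement of the ideal `(x ^ N, y ^ N)`. -/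
theorem exists_truncation (N : ℕ) : ∃ L : (Fin N × Fin N → ℂ) →ₗ[ℂ] FormalFn,
    ∀ f, ∃ c a b, f = L c + MvPowerSeries.X 0 ^ N * a + MvPowerSeries.X 1 ^ N * b := by
  refine ⟨{ toFun := fun c d => if h : d 0 < N ∧ d 1 < N then c (⟨d 0, h.1⟩, ⟨d 1, h.2⟩) else 0
            map_add' := ?_
            map_smul' := ?_ }, fun f => ?_⟩
  · intro c c'
    funext d
    change _ = (if h : d 0 < N ∧ d 1 < N then c (⟨d 0, h.1⟩, ⟨d 1, h.2⟩) else 0) +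
      (if h : d 0 < N ∧ d 1 < N then c' (⟨d 0, h.1⟩, ⟨d 1, h.2⟩) else 0)
    split_ifs <;> simp
  · intro r c
    funext d
    change _ = r • (if h : d 0 < N ∧ d 1 < N then c (⟨d 0, h.1⟩, ⟨d 1, h.2⟩) else 0)
    split_ifs <;> simp
  -- The monomials left out of the truncation are split without overlap: exponent of `x` at least
  -- `N`, or exponent of `x` below `N` and exponent of `y` at least `N`.
  · let f0 : FormalFn := fun d => if d 0 < N then 0 else MvPowerSeries.coeff d f
    let f1 : FormalFn := fun d =>
      if d 0 < N then (if d 1 < N then 0 else MvPowerSeries.coeff d f) else 0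
    obtain ⟨a, ha⟩ : MvPowerSeries.X 0 ^ N ∣ f0 :=
      MvPowerSeries.X_pow_dvd_iff.mpr fun m hm => if_pos hm
    obtain ⟨b, hb⟩ : MvPowerSeries.X 1 ^ N ∣ f1 := by
      refine MvPowerSeries.X_pow_dvd_iff.mpr fun m hm => ?_
      change (if m 0 < N then (if m 1 < N then 0 else MvPowerSeries.coeff m f) else 0) = 0
      simp [hm]
    refine ⟨fun ij => MvPowerSeries.coeff
      (Finsupp.single 0 (ij.1 : ℕ) + Finsupp.single 1 (ij.2 : ℕ)) f, a, b, ?_⟩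
    rw [← ha, ← hb]
    ext d
    have hd : Finsupp.single 0 (d 0) + Finsupp.single 1 (d 1) = d := by
      ext i; fin_cases i <;> simp
    simp only [map_add]
    change _ = (if h : d 0 < N ∧ d 1 < N then MvPowerSeries.coeff
      (Finsupp.single 0 (d 0) + Finsupp.single 1 (d 1)) f else 0) +
      (if d 0 < N then 0 else MvPowerSeries.coeff d f) +
      (if d 0 < N then (if d 1 < N then 0 else MvPowerSeries.coeff d f) else 0)
    rw [hd]
    by_cases h0 : d 0 < N <;> by_cases h1 : d 1 < N <;> simp [h0, h1]

/-- If `x ^ N` and `y ^ N` belong to the ideal `(a, b)`, then the syzygies of `(a, b)` are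
trivial. -/
theorem exists_eq_of_syzygy {N : ℕ} {a b : FormalFn}
    (h : ∀ i, (MvPowerSeries.X i : FormalFn) ^ N ∈ Ideal.span {a, b}) {u v : FormalFn}
    (huv : u * a + v * b = 0) : ∃ g, u = g * b ∧ v = -(g * a) := by
  have hX : ∀ i, (MvPowerSeries.X i : FormalFn) ^ N ≠ 0 := fun i =>
    pow_ne_zero _ fun h0 => by
      simpa [MvPowerSeries.coeff_X] using congrArg (MvPowerSeries.coeff (Finsupp.single i 1)) h0
  obtain ⟨α, β, h0⟩ := Ideal.mem_span_pair.mp (h 0)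
  obtain ⟨γ, ε, h1⟩ := Ideal.mem_span_pair.mp (h 1)
  -- If `u = g b` and `v = -g a`, then `β u - α v = g x ^ N`. This forces `g`, which exists because
  -- `x ^ N` and `y ^ N` are coprime.
  have key : (MvPowerSeries.X 1 : FormalFn) ^ N * (β * u - α * v) =
      MvPowerSeries.X 0 ^ N * (ε * u - γ * v) := by
    rw [← h0, ← h1]
    linear_combination (β * γ - α * ε) * huv
  have hdvd : (MvPowerSeries.X 0 : FormalFn) ^ N ∣ β * u - α * v := by
    refine MvPowerSeries.X_pow_dvd_iff.mpr fun m hm => ?_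
    have := MvPowerSeries.X_pow_dvd_iff.mp (Dvd.intro _ key.symm) (Finsupp.single 1 N + m)
      (by simpa using hm)
    rwa [MvPowerSeries.X_pow_eq, MvPowerSeries.coeff_add_monomial_mul, one_mul] at this
  obtain ⟨g, hg⟩ := hdvd
  refine ⟨g, mul_left_cancel₀ (hX 0) ?_, mul_left_cancel₀ (hX 0) ?_⟩
  · linear_combination (-u) * h0 + α * huv + b * hg
  · linear_combination (-v) * h0 + β * huv - a * hg

/-- The series `∑ h ^ k f k`, for `h` without constant term. -/
noncomputable def powSum (h : FormalFn) (f : ℕ → FormalFn) : FormalFn :=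
  fun d => MvPowerSeries.coeff d (∑ k ∈ Finset.range (d.degree + 1), h ^ k * f k)

theorem coeff_pow_mul_eq_zero {h : FormalFn} (hh : MvPowerSeries.constantCoeff h = 0)
    {k : ℕ} (f : FormalFn) {d : Fin 2 →₀ ℕ} (hd : d.degree < k) :
    MvPowerSeries.coeff d (h ^ k * f) = 0 := by
  apply MvPowerSeries.coeff_of_lt_order
  refine lt_of_lt_of_le (Nat.cast_lt.mpr hd) (le_trans ?_ MvPowerSeries.le_order_mul)
  exact le_add_right (MvPowerSeries.le_order_pow_of_constantCoeff_eq_zero k hh)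

theorem eq_zero_of_pow_dvd {h : FormalFn} (hh : MvPowerSeries.constantCoeff h = 0)
    {f : FormalFn} (hf : ∀ n, h ^ n ∣ f) : f = 0 := by
  ext d
  obtain ⟨g, rfl⟩ := hf (d.degree + 1)
  rw [coeff_pow_mul_eq_zero hh g (Nat.lt_succ_self _), map_zero]

theorem coeff_powSum {h : FormalFn} (hh : MvPowerSeries.constantCoeff h = 0)
    (f : ℕ → FormalFn) {d : Fin 2 →₀ ℕ} {n : ℕ} (hd : d.degree < n) :
    MvPowerSeries.coeff d (powSum h f) =
      MvPowerSeries.coeff d (∑ k ∈ Finset.range n, h ^ k * f k) := by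
  change MvPowerSeries.coeff d (∑ k ∈ Finset.range (d.degree + 1), h ^ k * f k) = _
  rw [map_sum, map_sum]
  refine Finset.sum_subset (Finset.range_mono hd) fun k _ hk => ?_
  exact coeff_pow_mul_eq_zero hh _ (by simpa using hk)

theorem powSum_eq {h : FormalFn} (hh : MvPowerSeries.constantCoeff h = 0) (f : ℕ → FormalFn) :
    powSum h f = f 0 + h * powSum h (fun k => f (k + 1)) := by
  ext d
  -- One term more than necessary is kept, so that removing `k = 0` leaves the range used for the
  -- shifted sum.
  rw [coeff_powSum hh f (show d.degree < d.degree + 1 + 1 by omega), Finset.sum_range_succ']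
  have : h * powSum h (fun k => f (k + 1)) -
      h * ∑ k ∈ Finset.range (d.degree + 1), h ^ k * f (k + 1) =
      h * (powSum h (fun k => f (k + 1)) -
        ∑ k ∈ Finset.range (d.degree + 1), h ^ k * f (k + 1)) := by ring
  have h2 : MvPowerSeries.coeff d (h * (powSum h (fun k => f (k + 1)) -
      ∑ k ∈ Finset.range (d.degree + 1), h ^ k * f (k + 1))) = 0 := by
    rw [MvPowerSeries.coeff_mul]
    refine Finset.sum_eq_zero fun e he => ?_
    rw [Finset.HasAntidiagonal.mem_antidiagonal] at he
    rw [map_sub, coeff_powSum hh _ (n := d.degree + 1), sub_self, mul_zero]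
    rw [← he, map_add]
    omega
  rw [← this, map_sub, sub_eq_zero] at h2
  rw [map_add, map_add, h2, Finset.mul_sum, add_comm]
  simp only [pow_succ', pow_zero, one_mul, mul_assoc]

/-- A recursion `b = a + h b'` can be summed. -/
theorem eq_powSum_of_rec {h : FormalFn} (hh : MvPowerSeries.constantCoeff h = 0)
    {b f : ℕ → FormalFn} (hb : ∀ n, b n = f n + h * b (n + 1)) : b 0 = powSum h f := by
  rw [← sub_eq_zero]
  refine eq_zero_of_pow_dvd hh fun n => ?_
  -- All tails are treated at once: the error at stage `m` is `h` times the error at stage `m + 1`.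
  suffices H : ∀ n m, h ^ n ∣ b m - powSum h (fun k => f (k + m)) by simpa using H n 0
  intro n
  induction n with
  | zero => simp
  | succ n ih =>
    intro m
    obtain ⟨e, he⟩ := ih (m + 1)
    refine ⟨e, ?_⟩
    have hf : (fun k => f (k + 1 + m)) = fun k => f (k + (m + 1)) :=
      funext fun k => by rw [add_assoc, add_comm 1]
    rw [powSum_eq hh, hb m, hf, zero_add]
    linear_combination h * he

/-! ### Isolated singularities and finiteness of the Milnor algebra -/

/-- The truncated subtraction is harmless: when `p i > δ`, the derivative is zero. -/
theorem isWeightedHomogeneous_pderiv {p : Fin 2 → ℕ} {δ : ℕ} {h : MvPolynomial (Fin 2) ℂ}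
    (hh : MvPolynomial.IsWeightedHomogeneous p h δ) (i : Fin 2) :
    MvPolynomial.IsWeightedHomogeneous p (MvPolynomial.pderiv i h) (δ - p i) := by
  intro d hd
  rw [MvPolynomial.coeff_pderiv] at hd
  have := hh (left_ne_zero_of_mul hd)
  rw [map_add, Finsupp.weight_single, one_smul] at this
  omega

theorem eval_weighted_smul {p : Fin 2 → ℕ} {n : ℕ} {f : MvPolynomial (Fin 2) ℂ}
    (hf : MvPolynomial.IsWeightedHomogeneous p f n) (t : ℂ) (z : Fin 2 → ℂ) :
    MvPolynomial.eval (fun i => t ^ p i * z i) f = t ^ n * MvPolynomial.eval z f := by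
  rw [MvPolynomial.eval_eq', MvPolynomial.eval_eq', Finset.mul_sum]
  refine Finset.sum_congr rfl fun d hd => ?_
  have hw := hf (MvPolynomial.mem_support_iff.mp hd)
  rw [Finsupp.weight_apply, Finsupp.sum_fintype _ _ (by simp)] at hw
  rw [← hw]
  simp only [Fin.prod_univ_two, Fin.sum_univ_two, smul_eq_mul, mul_pow, ← pow_mul, pow_add]
  rw [mul_comm (p 0), mul_comm (p 1)]
  ring

theorem X_sq_dvd (k : Fin 2) (f : MvPolynomial (Fin 2) ℂ)
    (hf : ∀ d, MvPolynomial.coeff d f ≠ 0 → 2 ≤ d k) : MvPolynomial.X k ^ 2 ∣ f := by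
  rw [f.as_sum]
  refine Finset.dvd_sum fun d hd => ?_
  rw [MvPolynomial.X_pow_eq_monomial, MvPolynomial.monomial_dvd_monomial]
  exact ⟨Or.inr (by simpa [Finsupp.single_le_iff] using hf d (MvPolynomial.mem_support_iff.mp hd)),
    one_dvd _⟩

namespace QHSingularity

variable (D : QHSingularity)

/-- Otherwise both partial derivatives would vanish on a whole coordinate axis through `0`. -/
theorem not_X_sq_dvd (k : Fin 2) : ¬ MvPolynomial.X k ^ 2 ∣ D.h := by
  rintro ⟨q, hq⟩
  obtain ⟨l, hl⟩ : ∃ l : Fin 2, l ≠ k := exists_ne k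
  have hzero : ∀ i, ∀ t : ℂ,
      MvPolynomial.eval (Pi.single l t) (MvPolynomial.pderiv i D.h) = 0 := by
    intro i t
    simp [hq, Derivation.leibniz, Derivation.leibniz_pow, Pi.single_eq_of_ne hl.symm]
  have ht : Tendsto (fun t : ℂ => (Pi.single l t : Fin 2 → ℂ)) (𝓝[≠] 0) (𝓝[≠] 0) := by
    refine tendsto_nhdsWithin_iff.mpr ⟨?_, ?_⟩
    · have hc : Continuous fun t : ℂ => (Pi.single l t : Fin 2 → ℂ) :=
        continuous_pi fun i => by
          rcases eq_or_ne i l with rfl | hi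
          · simpa using continuous_id'
          · simpa [hi] using continuous_const
      simpa using (hc.tendsto 0).mono_left nhdsWithin_le_nhds
    · filter_upwards [self_mem_nhdsWithin] with t ht
      simpa using ht
  obtain ⟨t, h⟩ := (ht.eventually D.isolated).exists
  exact h ⟨hzero 0 t, hzero 1 t⟩

/-- The weighted dilations preserve the critical set and, the weights being positive, move any
critical point arbitrarily close to `0`. -/
theorem eq_zero_of_critical (hp : ∀ i, 0 < D.p i) {z : Fin 2 → ℂ}
    (hz : ∀ i, MvPolynomial.eval z (MvPolynomial.pderiv i D.h) = 0) : z = 0 := by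
  by_contra hne
  have ht : Tendsto (fun t : ℂ => (fun i => t ^ D.p i * z i : Fin 2 → ℂ)) (𝓝[≠] 0) (𝓝[≠] 0) := by
    refine tendsto_nhdsWithin_iff.mpr ⟨?_, ?_⟩
    · have hc : Continuous fun t : ℂ => (fun i => t ^ D.p i * z i : Fin 2 → ℂ) := by fun_prop
      have h0 : (fun i => (0 : ℂ) ^ D.p i * z i : Fin 2 → ℂ) = 0 := by
        funext i; simp [(hp i).ne']
      simpa only [h0] using (hc.tendsto 0).mono_left nhdsWithin_le_nhds
    · filter_upwards [self_mem_nhdsWithin] with t ht h0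
      refine hne (funext fun i => ?_)
      have := congrFun h0 i
      simpa [pow_ne_zero _ (show t ≠ 0 from ht)] using this
  obtain ⟨t, h⟩ := (ht.eventually D.isolated).exists
  refine h ⟨?_, ?_⟩ <;>
  rw [eval_weighted_smul (isWeightedHomogeneous_pderiv D.quasiHomogeneous _), hz, mul_zero]

theorem coe_pderiv (i : Fin 2) :
    ((MvPolynomial.pderiv i D.h : MvPolynomial (Fin 2) ℂ) : FormalFn) =
      MvPowerSeries.pderiv ℂ i D.hs :=
  (MvPowerSeries.pderiv_coe D.h).symm

theorem pderiv_one_hs : MvPowerSeries.pderiv ℂ 1 D.hs = (D.δ : FormalFn) * D.X₀ 0 := by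
  have hδ : (D.δ : ℂ) ≠ 0 := Nat.cast_ne_zero.mpr D.δ_pos.ne'
  rw [← nsmul_eq_mul, ← Nat.cast_smul_eq_nsmul ℂ, X₀, Matrix.cons_val_zero, smul_smul,
    mul_inv_cancel₀ hδ, one_smul]

theorem pderiv_zero_hs : MvPowerSeries.pderiv ℂ 0 D.hs = -((D.δ : FormalFn) * D.X₀ 1) := by
  have hδ : (D.δ : ℂ) ≠ 0 := Nat.cast_ne_zero.mpr D.δ_pos.ne'
  rw [← nsmul_eq_mul, ← Nat.cast_smul_eq_nsmul ℂ, X₀, Matrix.cons_val_one, Matrix.cons_val_fin_one,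
    smul_neg, smul_smul, mul_inv_cancel₀ hδ, one_smul, neg_neg]

theorem pderiv_mem_J₀ (i : Fin 2) : MvPowerSeries.pderiv ℂ i D.hs ∈ D.J₀ := by
  fin_cases i
  · exact D.pderiv_zero_hs ▸ neg_mem (Ideal.mul_mem_left _ _ (Ideal.subset_span (by simp)))
  · exact D.pderiv_one_hs ▸ Ideal.mul_mem_left _ _ (Ideal.subset_span (by simp))

theorem exists_X_pow_mem_of_pos (hp : ∀ i, 0 < D.p i) (i : Fin 2) :
    ∃ N, (MvPowerSeries.X i : FormalFn) ^ N ∈ D.J₀ := by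
  let I : Ideal (MvPolynomial (Fin 2) ℂ) :=
    Ideal.span (Set.range fun i => MvPolynomial.pderiv i D.h)
  have hX : MvPolynomial.X i ∈ I.radical := by
    rw [← MvPolynomial.vanishingIdeal_zeroLocus_eq_radical (K := ℂ) I]
    intro z hz
    have : z = 0 := D.eq_zero_of_critical hp fun j => by
      have := hz _ (Ideal.subset_span (Set.mem_range_self j))
      simpa [MvPolynomial.aeval_eq_eval] using this
    simp [this]
  obtain ⟨N, hN⟩ := hX
  refine ⟨N, ?_⟩
  have hle : I ≤ D.J₀.comap (MvPolynomial.coeToMvPowerSeries.ringHom (σ := Fin 2) (R := ℂ)) := by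
    refine Ideal.span_le.mpr ?_
    rintro _ ⟨j, rfl⟩
    simpa [coe_pderiv] using D.pderiv_mem_J₀ j
  simpa using hle hN

/-- Here `h = q(x_i) x_j ^ δ`, and `not_X_sq_dvd` forces `δ = 1` and `q` to vanish to order at most
`1` at `0`. If `q(0) ≠ 0`, then `∂_j h = q` is a unit. Otherwise `∂_j h` and `∂_i h` are `x_i` and
`x_j` times units. -/
theorem exists_X_pow_mem_of_eq_zero {i j : Fin 2} (hij : i ≠ j) (hi : D.p i = 0)
    (hj : D.p j = 1) : (MvPowerSeries.X i : FormalFn) ∈ D.J₀ ∧ MvPowerSeries.X j ∈ D.J₀ := by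
  have hw : ∀ d : Fin 2 →₀ ℕ, Finsupp.weight D.p d = d j := by
    intro d
    rw [Finsupp.weight_apply, Finsupp.sum_fintype _ _ (by simp)]
    fin_cases i <;> fin_cases j <;> simp_all
  have hsupp : ∀ d, MvPowerSeries.coeff d D.hs ≠ 0 → d j = D.δ := by
    intro d hd
    rw [hs, MvPolynomial.coeff_coe] at hd
    rw [← hw, D.quasiHomogeneous hd]
  have hδ : D.δ = 1 := by
    by_contra hne
    refine D.not_X_sq_dvd j (X_sq_dvd j _ fun d hd => ?_)
    rw [hsupp d (by rwa [hs, MvPolynomial.coeff_coe])]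
    have := D.δ_pos
    omega
  have hext : ∀ {d d' : Fin 2 →₀ ℕ}, d i = d' i → d j = d' j → d = d' := by
    intro d d' h h'
    ext k
    fin_cases i <;> fin_cases j <;> fin_cases k <;> simp_all
  obtain ⟨d, hd, hdi⟩ : ∃ d, MvPowerSeries.coeff d D.hs ≠ 0 ∧ d i < 2 := by
    by_contra! hcon
    exact D.not_X_sq_dvd i (X_sq_dvd i _ fun d hd =>
      hcon d (by rwa [hs, MvPolynomial.coeff_coe]))
  have hdj := hsupp d hd
  -- As `δ = 1`, the series `∂_j h` involves `x_i` only. Without constant term it is therefore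
  -- divisible by `x_i`.
  have key : ∀ e, MvPowerSeries.constantCoeff (MvPowerSeries.pderiv ℂ j D.hs) = 0 →
      e i = 0 → MvPowerSeries.coeff e (MvPowerSeries.pderiv ℂ j D.hs) = 0 := by
    intro e h0 he
    by_cases hej : e j = 0
    · rwa [show e = 0 from hext (by simpa using he) (by simpa using hej)]
    · rw [MvPowerSeries.coeff_pderiv]
      by_contra hne
      have := hsupp _ (left_ne_zero_of_mul hne)
      simp at this
      omega
  by_cases h0 : MvPowerSeries.constantCoeff (MvPowerSeries.pderiv ℂ j D.hs) = 0
  · have hdi1 : d i = 1 := by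
      by_contra hne
      have hd' : d = 0 + Finsupp.single j 1 := hext (by simp [hij]; omega) (by simp; omega)
      rw [← MvPowerSeries.coeff_zero_eq_constantCoeff_apply, MvPowerSeries.coeff_pderiv, ← hd'] at h0
      simp [hd] at h0
    obtain ⟨u, hu⟩ := MvPowerSeries.X_dvd_iff.mpr fun e he => key e h0 he
    obtain ⟨v, hv⟩ : MvPowerSeries.X j ∣ MvPowerSeries.pderiv ℂ i D.hs := by
      refine MvPowerSeries.X_dvd_iff.mpr fun e he => ?_
      rw [MvPowerSeries.coeff_pderiv]
      by_contra hne
      have := hsupp _ (left_ne_zero_of_mul hne)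
      simp [he, hij] at this
      omega
    have hu0 : IsUnit u := by
      rw [MvPowerSeries.isUnit_iff_constantCoeff, isUnit_iff_ne_zero]
      intro hu0
      have h1 := congrArg (MvPowerSeries.coeff (Finsupp.single i 1 + 0)) hu
      rw [MvPowerSeries.X, MvPowerSeries.coeff_add_monomial_mul,
        MvPowerSeries.coeff_zero_eq_constantCoeff_apply, hu0, MvPowerSeries.coeff_pderiv,
        show Finsupp.single i 1 + 0 + Finsupp.single j 1 = d from
          hext (by simp [hij, hdi1]) (by simp [hij, hdj, hδ])] at h1
      simp [hd, hij] at h1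
    have hv0 : IsUnit v := by
      rw [MvPowerSeries.isUnit_iff_constantCoeff, isUnit_iff_ne_zero]
      intro hv0
      have h1 := congrArg (MvPowerSeries.coeff (Finsupp.single j 1 + 0)) hv
      rw [MvPowerSeries.X, MvPowerSeries.coeff_add_monomial_mul,
        MvPowerSeries.coeff_zero_eq_constantCoeff_apply, hv0, MvPowerSeries.coeff_pderiv,
        show Finsupp.single j 1 + 0 + Finsupp.single i 1 = d from
          hext (by simp [hij, hdi1]) (by simp [hij, hdj, hδ])] at h1
      simp [hd, hij] at h1
    exact ⟨(Ideal.mul_unit_mem_iff_mem _ hu0).mp (hu ▸ D.pderiv_mem_J₀ j),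
      (Ideal.mul_unit_mem_iff_mem _ hv0).mp (hv ▸ D.pderiv_mem_J₀ i)⟩
  · have htop : D.J₀ = ⊤ := Ideal.eq_top_of_isUnit_mem _ (D.pderiv_mem_J₀ j)
      (MvPowerSeries.isUnit_iff_constantCoeff.mpr (isUnit_iff_ne_zero.mpr h0))
    simp [htop]

theorem weights_cases : (∀ i, 0 < D.p i) ∨ ∃ i j, i ≠ j ∧ D.p i = 0 ∧ D.p j = 1 := by
  have hc := D.coprime_p
  by_cases h0 : D.p 0 = 0
  · exact Or.inr ⟨0, 1, by decide, h0, by simpa [h0] using hc⟩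
  by_cases h1 : D.p 1 = 0
  · exact Or.inr ⟨1, 0, by decide, h1, by simpa [h1] using hc⟩
  · refine Or.inl fun i => ?_
    fin_cases i
    · exact Nat.pos_of_ne_zero h0
    · exact Nat.pos_of_ne_zero h1

theorem exists_X_pow_mem_J₀ : ∃ N, ∀ i, (MvPowerSeries.X i : FormalFn) ^ N ∈ D.J₀ := by
  rcases D.weights_cases with hp | ⟨i, j, hij, hi, hj⟩
  · obtain ⟨M, hM⟩ := D.exists_X_pow_mem_of_pos hp 0
    obtain ⟨N, hN⟩ := D.exists_X_pow_mem_of_pos hp 1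
    refine ⟨M + N, fun i => ?_⟩
    fin_cases i
    · exact pow_add (MvPowerSeries.X 0 : FormalFn) M N ▸ Ideal.mul_mem_right _ _ hM
    · exact pow_add (MvPowerSeries.X 1 : FormalFn) M N ▸ Ideal.mul_mem_left _ _ hN
  · obtain ⟨h1, h2⟩ := D.exists_X_pow_mem_of_eq_zero hij hi hj
    refine ⟨1, fun k => ?_⟩
    rw [pow_one]
    fin_cases i <;> fin_cases j <;> fin_cases k <;> simp_all

theorem finite_quotient_J₀ : Module.Finite ℂ (FormalFn ⧸ D.J₀) := by
  obtain ⟨N, hN⟩ := D.exists_X_pow_mem_J₀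
  obtain ⟨L, hL⟩ := exists_truncation N
  refine Module.Finite.of_surjective ((Ideal.Quotient.mkₐ ℂ D.J₀).toLinearMap.comp L) fun q => ?_
  obtain ⟨f, rfl⟩ := Ideal.Quotient.mk_surjective q
  obtain ⟨c, a, b, hf⟩ := hL f
  refine ⟨c, ?_⟩
  change Ideal.Quotient.mk D.J₀ (L c) = _
  rw [eq_comm, Ideal.Quotient.eq, hf, add_assoc, add_sub_cancel_left]
  exact add_mem (Ideal.mul_mem_right _ _ (hN 0)) (Ideal.mul_mem_right _ _ (hN 1))

theorem exists_eq_of_X₀_syzygy {u v : FormalFn} (h : u * D.X₀ 0 + v * D.X₀ 1 = 0) :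
    ∃ g, u = g * D.X₀ 1 ∧ v = -(g * D.X₀ 0) := by
  obtain ⟨N, hN⟩ := D.exists_X_pow_mem_J₀
  exact exists_eq_of_syzygy hN h

/-! ### The grading by `R`, torsion in `Coker(X₀)` and its reduction modulo `h` -/

theorem δ_ne_zero : (D.δ : FormalFn) ≠ 0 := by
  rw [← map_natCast (algebraMap ℂ FormalFn)]
  exact (map_ne_zero _).mpr (Nat.cast_ne_zero.mpr D.δ_pos.ne')

theorem hs_eq : D.hs = (D.p 1 : FormalFn) * MvPowerSeries.X 1 * D.X₀ 0 -
    (D.p 0 : FormalFn) * MvPowerSeries.X 0 * D.X₀ 1 := by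
  refine mul_left_cancel₀ D.δ_ne_zero ?_
  rw [← D.euler, FormalField.der_apply, pderiv_zero_hs, pderiv_one_hs, R, R]
  ring

theorem div_X₀ : MvPowerSeries.pderiv ℂ 0 (D.X₀ 0) + MvPowerSeries.pderiv ℂ 1 (D.X₀ 1) = 0 := by
  simp only [X₀, Matrix.cons_val_zero, Matrix.cons_val_one, Matrix.cons_val_fin_one, map_neg,
    Derivation.map_smul]
  rw [pderiv_pderiv_comm 0 1, add_neg_cancel]

theorem R_der_apply (f : FormalFn) : D.R.der f =
    (D.p 0 : FormalFn) * MvPowerSeries.X 0 * MvPowerSeries.pderiv ℂ 0 f +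
    (D.p 1 : FormalFn) * MvPowerSeries.X 1 * MvPowerSeries.pderiv ℂ 1 f := rfl

theorem coeff_R_der (f : FormalFn) (d : Fin 2 →₀ ℕ) : MvPowerSeries.coeff d (D.R.der f) =
    ((D.p 0 * d 0 + D.p 1 * d 1 : ℕ) : ℂ) * MvPowerSeries.coeff d f := by
  rw [R_der_apply, mul_assoc, mul_assoc, ← nsmul_eq_mul, ← nsmul_eq_mul, map_add, map_nsmul,
    map_nsmul, coeff_X_mul_pderiv, coeff_X_mul_pderiv]
  simp only [nsmul_eq_mul]
  push_cast
  ring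

theorem coeff_R_der_add (c : ℕ) (f : FormalFn) (d : Fin 2 →₀ ℕ) :
    MvPowerSeries.coeff d (D.R.der f + (c : FormalFn) * f) =
    ((D.p 0 * d 0 + D.p 1 * d 1 + c : ℕ) : ℂ) * MvPowerSeries.coeff d f := by
  rw [map_add, coeff_R_der, ← nsmul_eq_mul (n := c), map_nsmul, nsmul_eq_mul]
  push_cast
  ring

/-- `R` multiplies each monomial by its weight, so `R + c` is diagonal with nonzero eigenvalues. -/
theorem exists_R_der_add_eq {c : ℕ} (hc : 0 < c) (f : FormalFn) :
    ∃ g, D.R.der g + (c : FormalFn) * g = f := by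
  let g : FormalFn :=
    fun d => ((D.p 0 * d 0 + D.p 1 * d 1 + c : ℕ) : ℂ)⁻¹ * MvPowerSeries.coeff d f
  refine ⟨g, ?_⟩
  ext d
  rw [coeff_R_der_add]
  exact mul_inv_cancel_left₀ (Nat.cast_ne_zero.mpr (by omega)) _

theorem eq_zero_of_R_der_add {c : ℕ} (hc : 0 < c) {f : FormalFn}
    (hf : D.R.der f + (c : FormalFn) * f = 0) : f = 0 := by
  ext d
  have h := congrArg (MvPowerSeries.coeff d) hf
  rw [coeff_R_der_add, (MvPowerSeries.coeff d).map_zero] at h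
  exact (mul_eq_zero.mp h).resolve_left (Nat.cast_ne_zero.mpr (by omega))

/-- Differentiating `hs_eq` in `y` gives this up to a cross term, which `div_X₀` converts into an
`x`-derivative of `D.X₀ 0`. -/
theorem R_der_X₀_zero : D.R.der (D.X₀ 0) = ((D.δ : FormalFn) - (D.p 1 : FormalFn)) * D.X₀ 0 := by
  have h := congrArg (MvPowerSeries.pderiv ℂ 1) D.hs_eq
  simp only [map_sub, Derivation.leibniz, smul_eq_mul, Derivation.map_natCast, pderiv_one_hs,
    MvPowerSeries.pderiv_X_self, MvPowerSeries.pderiv_X_of_ne (show (0 : Fin 2) ≠ 1 by decide)] at h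
  rw [R_der_apply]
  linear_combination -h + (D.p 0 : FormalFn) * MvPowerSeries.X 0 * D.div_X₀

theorem R_der_X₀_one : D.R.der (D.X₀ 1) = ((D.δ : FormalFn) - (D.p 0 : FormalFn)) * D.X₀ 1 := by
  have h := congrArg (MvPowerSeries.pderiv ℂ 0) D.hs_eq
  simp only [map_sub, Derivation.leibniz, smul_eq_mul, Derivation.map_natCast, pderiv_zero_hs,
    MvPowerSeries.pderiv_X_self, MvPowerSeries.pderiv_X_of_ne (show (1 : Fin 2) ≠ 0 by decide)] at h
  rw [R_der_apply]
  linear_combination h + (D.p 1 : FormalFn) * MvPowerSeries.X 1 * D.div_X₀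

theorem pderiv_zero_R_der (f : FormalFn) : MvPowerSeries.pderiv ℂ 0 (D.R.der f) =
    (D.p 0 : FormalFn) * MvPowerSeries.pderiv ℂ 0 f + D.R.der (MvPowerSeries.pderiv ℂ 0 f) := by
  simp only [R_der_apply, map_add, Derivation.leibniz, smul_eq_mul, Derivation.map_natCast,
    MvPowerSeries.pderiv_X_self, MvPowerSeries.pderiv_X_of_ne (show (1 : Fin 2) ≠ 0 by decide),
    pderiv_pderiv_comm 0 1]
  ring

theorem pderiv_one_R_der (f : FormalFn) : MvPowerSeries.pderiv ℂ 1 (D.R.der f) =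
    (D.p 1 : FormalFn) * MvPowerSeries.pderiv ℂ 1 f + D.R.der (MvPowerSeries.pderiv ℂ 1 f) := by
  simp only [R_der_apply, map_add, Derivation.leibniz, smul_eq_mul, Derivation.map_natCast,
    MvPowerSeries.pderiv_X_self, MvPowerSeries.pderiv_X_of_ne (show (0 : Fin 2) ≠ 1 by decide),
    pderiv_pderiv_comm 0 1]
  ring

/-- The commutation of `R` with `X₀`. -/
theorem R_der_X₀_der (f : FormalFn) :
    D.R.der (D.X₀.der f) + ((D.p 0 + D.p 1 : ℕ) : FormalFn) * D.X₀.der f =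
      D.X₀.der (D.R.der f + (D.δ : FormalFn) * f) := by
  simp only [FormalField.der_apply D.X₀, map_add, Derivation.leibniz, smul_eq_mul,
    Derivation.map_natCast, pderiv_zero_R_der, pderiv_one_R_der, R_der_X₀_zero, R_der_X₀_one]
  push_cast
  ring

/-- `Coker(X₀)` has no `h`-torsion. -/
theorem exists_X₀_der_eq_of_hs_mul {b f : FormalFn} (h : D.hs * b = D.X₀.der f) :
    ∃ g, D.X₀.der g = b := by
  have h0 := h
  rw [D.hs_eq, FormalField.der_apply] at h0
  -- With `h` replaced by its determinant formula, the hypothesis is a syzygy. It says that `b (p₂ y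
  -- dx - p₁ x dy) - df` is a multiple of `dh`. Taking the exterior derivative eliminates `f`.
  obtain ⟨g, h1, h2⟩ := D.exists_eq_of_X₀_syzygy
    (u := (D.p 1 : FormalFn) * MvPowerSeries.X 1 * b - MvPowerSeries.pderiv ℂ 0 f)
    (v := -((D.p 0 : FormalFn) * MvPowerSeries.X 0 * b) - MvPowerSeries.pderiv ℂ 1 f)
    (by linear_combination h0)
  replace h1 := congrArg (MvPowerSeries.pderiv ℂ 1) h1
  replace h2 := congrArg (MvPowerSeries.pderiv ℂ 0) h2
  simp only [map_sub, map_neg, Derivation.leibniz, smul_eq_mul, Derivation.map_natCast,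
    MvPowerSeries.pderiv_X_self, pderiv_pderiv_comm 0 1] at h1 h2
  have hb : D.R.der b + ((D.p 0 + D.p 1 : ℕ) : FormalFn) * b = D.X₀.der g := by
    rw [R_der_apply, FormalField.der_apply]
    push_cast
    linear_combination h1 - h2 + g * D.div_X₀
  have hc : 0 < D.p 0 + D.p 1 := by
    rcases D.weights_cases with hp | ⟨i, j, -, -, hj⟩
    · exact Nat.add_pos_left (hp 0) _
    · fin_cases j <;> simp_all
  -- Writing `g = (R + δ) g'` moves `R` across `X₀`, so `b - X₀(g')` is killed by the injective
  -- operator `R + p₁ + p₂`.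
  obtain ⟨g', rfl⟩ := D.exists_R_der_add_eq D.δ_pos g
  refine ⟨g', (sub_eq_zero.mp (D.eq_zero_of_R_der_add hc ?_)).symm⟩
  rw [← R_der_X₀_der] at hb
  rw [map_sub]
  linear_combination hb

/-- `R + p_i` is the Lie derivative along `R` on the coefficient of `dx_i`. It is invertible unless
`p_i = 0`; then it kills the series in `x_i` alone, which are instead integrated to `G`. -/
theorem exists_pderiv_add_R_der {i j : Fin 2} (hij : i ≠ j) (u : FormalFn) :
    ∃ G u', u = MvPowerSeries.pderiv ℂ i G + (D.R.der u' + (D.p i : FormalFn) * u') ∧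
      MvPowerSeries.pderiv ℂ j G = 0 := by
  rcases Nat.eq_zero_or_pos (D.p i) with hi | hi
  · have hj : D.p j = 1 := by
      rcases D.weights_cases with hp | ⟨i', j', hij', hi', hj'⟩
      · exact absurd hi (hp i).ne'
      · fin_cases i <;> fin_cases j <;> fin_cases i' <;> fin_cases j' <;> simp_all
    have hw : ∀ d : Fin 2 →₀ ℕ, D.p 0 * d 0 + D.p 1 * d 1 + D.p i = d j := by
      intro d
      fin_cases i <;> fin_cases j <;> simp_all
    -- Division by zero does no harm: `∂_i` ignores the terms of `G` with `d i = 0`, and `R + p_i`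
    -- multiplies those of `u'` with `d j = 0` by `0`.
    let G : FormalFn := fun d =>
      if d j = 0 then MvPowerSeries.coeff (d - Finsupp.single i 1) u / (d i : ℂ) else 0
    let u' : FormalFn := fun d => MvPowerSeries.coeff d u / (d j : ℂ)
    have hG : ∀ d, MvPowerSeries.coeff d G =
      if d j = 0 then MvPowerSeries.coeff (d - Finsupp.single i 1) u / (d i : ℂ) else 0 :=
      fun d => rfl
    have hu' : ∀ d, MvPowerSeries.coeff d u' = MvPowerSeries.coeff d u / (d j : ℂ) :=
      fun d => rfl
    refine ⟨G, u', ?_, ?_⟩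
    · ext d
      rw [map_add, coeff_R_der_add, hw, hu', MvPowerSeries.coeff_pderiv, hG, add_tsub_cancel_right]
      have hne : (d i : ℂ) + 1 ≠ 0 := Nat.cast_add_one_ne_zero _
      by_cases hd : d j = 0
      · simp [hd, hij, hne]
      · have : (d j : ℂ) ≠ 0 := Nat.cast_ne_zero.mpr hd
        simp only [Finsupp.add_apply, Finsupp.single_eq_of_ne hij.symm, add_zero, hd, if_false,
          zero_mul, zero_add]
        field_simp
    · ext d
      rw [MvPowerSeries.coeff_pderiv, hG]
      simp
  · obtain ⟨u', hu'⟩ := D.exists_R_der_add_eq hi u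
    exact ⟨0, u', by simp [hu'], by simp⟩

/-- `J₀ = X₀(ℂ[[x, y]]) + (h)`. -/
theorem exists_of_mem_J₀ {f : FormalFn} (hf : f ∈ D.J₀) :
    ∃ F g, f = D.X₀.der F + D.hs * g := by
  obtain ⟨a, b, rfl⟩ := Ideal.mem_span_pair.mp hf
  obtain ⟨G, a', ha, hG⟩ := D.exists_pderiv_add_R_der (show (0 : Fin 2) ≠ 1 by decide) a
  obtain ⟨H, b', hb, hH⟩ := D.exists_pderiv_add_R_der (show (1 : Fin 2) ≠ 0 by decide) b
  -- Cartan's formula `L_R η = d(i_R η) + i_R dη` for `η = a' dx + b' dy`: contraction with `X₀`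
  -- turns the exact part into `X₀` of a function and the other into a multiple of `h`.
  refine ⟨G + H + ((D.p 0 : FormalFn) * MvPowerSeries.X 0 * a' +
    (D.p 1 : FormalFn) * MvPowerSeries.X 1 * b'),
    MvPowerSeries.pderiv ℂ 1 a' - MvPowerSeries.pderiv ℂ 0 b', ?_⟩
  rw [R_der_apply] at ha hb
  simp only [FormalField.der_apply, map_add, Derivation.leibniz, smul_eq_mul,
    Derivation.map_natCast, MvPowerSeries.pderiv_X_self,
    MvPowerSeries.pderiv_X_of_ne (show (0 : Fin 2) ≠ 1 by decide),
    MvPowerSeries.pderiv_X_of_ne (show (1 : Fin 2) ≠ 0 by decide), hG, hH]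
  linear_combination D.X₀ 0 * ha + D.X₀ 1 * hb -
    (MvPowerSeries.pderiv ℂ 1 a' - MvPowerSeries.pderiv ℂ 0 b') * D.hs_eq

theorem hs_mem_J₀ : D.hs ∈ D.J₀ := by
  rw [D.hs_eq]
  exact sub_mem (Ideal.mul_mem_left _ _ (Ideal.subset_span (by simp)))
    (Ideal.mul_mem_left _ _ (Ideal.subset_span (by simp)))

theorem X₀_der_mem_J₀ (f : FormalFn) : D.X₀.der f ∈ D.J₀ := by
  rw [FormalField.der_apply]
  exact add_mem (Ideal.mul_mem_right _ _ (Ideal.subset_span (by simp)))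
    (Ideal.mul_mem_right _ _ (Ideal.subset_span (by simp)))

/-! ### Lifting a basis from the Milnor algebra to `Coker(X₀)` -/

theorem substAlgHom_hs_eq (l : PowerSeries ℂ) :
    PowerSeries.substAlgHom (R := ℂ) D.hasSubst_hs l =
      algebraMap ℂ FormalFn (PowerSeries.coeff 0 l) + D.hs *
        PowerSeries.substAlgHom (R := ℂ) D.hasSubst_hs
          (PowerSeries.mk fun i => PowerSeries.coeff (i + 1) l) := by
  have hC : PowerSeries.substAlgHom (R := ℂ) D.hasSubst_hs
      (PowerSeries.C (PowerSeries.constantCoeff l)) =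
      algebraMap ℂ FormalFn (PowerSeries.constantCoeff l) :=
    AlgHom.commutes (PowerSeries.substAlgHom (R := ℂ) D.hasSubst_hs) _
  conv_lhs => rw [PowerSeries.eq_X_mul_shift_add_const l]
  rw [map_add, map_mul, PowerSeries.substAlgHom_X, hC, add_comm,
    PowerSeries.coeff_zero_eq_constantCoeff_apply]

theorem exists_Ch_eq (c : D.Ch) : ∃ (k : ℂ) (c' : D.Ch),
    (c : FormalFn) = algebraMap ℂ FormalFn k + D.hs * c' := by
  obtain ⟨_, l, rfl⟩ := c
  exact ⟨_, ⟨_, _, rfl⟩, D.substAlgHom_hs_eq l⟩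

section Basis

variable {ι : Type*} [Fintype ι] {a : ι → FormalFn} (α : Module.Basis ι ℂ (FormalFn ⧸ D.J₀))
  (ha : ∀ i, α i = Ideal.Quotient.mk D.J₀ (a i))

include ha

theorem mk_sum_algebraMap_mul (k : ι → ℂ) :
    Ideal.Quotient.mk D.J₀ (∑ i, algebraMap ℂ FormalFn (k i) * a i) = ∑ i, k i • α i := by
  rw [map_sum]
  refine Finset.sum_congr rfl fun i _ => ?_
  rw [ha, ← Algebra.smul_def]
  rfl

theorem exists_step (b : FormalFn) : ∃ (k : ι → ℂ) (F b' : FormalFn),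
    b = (∑ i, algebraMap ℂ FormalFn (k i) * a i + D.X₀.der F) + D.hs * b' := by
  let k := α.repr (Ideal.Quotient.mk D.J₀ b)
  have hk : b - ∑ i, algebraMap ℂ FormalFn (k i) * a i ∈ D.J₀ := by
    rw [← Ideal.Quotient.eq, mk_sum_algebraMap_mul D α ha, α.sum_repr]
  obtain ⟨F, g, h⟩ := D.exists_of_mem_J₀ hk
  exact ⟨k, F, g, by linear_combination h⟩

theorem exists_generation (b : FormalFn) : ∃ (c : ι → D.Ch) (F : FormalFn),
    b = ∑ i, (c i : FormalFn) * a i + D.X₀.der F := by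
  choose k F b' hb using D.exists_step α ha
  -- `B n` is the remainder after `n` divisions by `h`, and `s i n` is the series of the
  -- coefficients of `a i` found from stage `n` on.
  let B : ℕ → FormalFn := fun n => b'^[n] b
  let s : ι → ℕ → FormalFn := fun i n => PowerSeries.substAlgHom (R := ℂ) D.hasSubst_hs
    (PowerSeries.mk fun m => k (B (m + n)) i)
  let f : ℕ → FormalFn := fun n =>
    ∑ i, algebraMap ℂ FormalFn (k (B n) i) * a i + D.X₀.der (F (B n))
  have hs : ∀ i n, s i n = algebraMap ℂ FormalFn (k (B n) i) + D.hs * s i (n + 1) := by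
    intro i n
    have h := D.substAlgHom_hs_eq (PowerSeries.mk fun m => k (B (m + n)) i)
    simp only [PowerSeries.coeff_mk, zero_add] at h
    have he : (fun m => k (B (m + 1 + n)) i) = fun m => k (B (m + (n + 1))) i :=
      funext fun m => by rw [add_assoc, add_comm 1]
    rwa [he] at h
  have hB : ∀ n, B n = f n + D.hs * B (n + 1) := fun n => by
    have h := hb (B n)
    rwa [show b' (B n) = B (n + 1) from (Function.iterate_succ_apply' b' n b).symm] at h
  -- The proposed sum obeys the same recursion as `B`, because `X₀(h) = 0` lets `X₀` commute with
  -- `h`. The recursion has only one solution.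
  have hC : ∀ n, ∑ i, s i n * a i + D.X₀.der (powSum D.hs fun m => F (B (m + n))) =
      f n + D.hs * (∑ i, s i (n + 1) * a i +
        D.X₀.der (powSum D.hs fun m => F (B (m + (n + 1))))) := by
    intro n
    have he : (fun m => F (B (m + 1 + n))) = fun m => F (B (m + (n + 1))) :=
      funext fun m => by rw [add_assoc, add_comm 1]
    have hsum : ∑ i, s i n * a i = ∑ i, algebraMap ℂ FormalFn (k (B n) i) * a i +
        D.hs * ∑ i, s i (n + 1) * a i := by
      rw [Finset.mul_sum, ← Finset.sum_add_distrib]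
      exact Finset.sum_congr rfl fun i _ => by rw [hs]; ring
    rw [powSum_eq D.constantCoeff_hs, he, zero_add, hsum, map_add, Derivation.leibniz, D.X₀_hs,
      smul_zero, add_zero, smul_eq_mul]
    simp only [f]
    ring
  have h1 := eq_powSum_of_rec D.constantCoeff_hs hB
  have h2 := eq_powSum_of_rec D.constantCoeff_hs hC
  exact ⟨fun i => ⟨s i 0, _, rfl⟩, _, (h1.trans h2.symm)⟩

/-- Modulo `J₀` the constant terms of the `c i` vanish. Absence of torsion then cancels a factor
`h`, and repetition makes each `c i` divisible by every power of `h`. -/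
theorem eq_zero_of_sum_mul_eq_X₀_der (c : ι → D.Ch) (F : FormalFn)
    (h : ∑ i, (c i : FormalFn) * a i = D.X₀.der F) : c = 0 := by
  suffices H : ∀ (n : ℕ) (c : ι → D.Ch) (F : FormalFn),
      ∑ i, (c i : FormalFn) * a i = D.X₀.der F → ∀ i, D.hs ^ n ∣ (c i : FormalFn) from
    funext fun i => Subtype.ext (eq_zero_of_pow_dvd D.constantCoeff_hs fun n => H n c F h i)
  intro n
  induction n with
  | zero => simp
  | succ n ih =>
    intro c F h
    choose k c' hc using fun i => D.exists_Ch_eq (c i)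
    have hsum : ∑ i, (c i : FormalFn) * a i =
        ∑ i, algebraMap ℂ FormalFn (k i) * a i + D.hs * ∑ i, (c' i : FormalFn) * a i := by
      rw [Finset.mul_sum, ← Finset.sum_add_distrib]
      exact Finset.sum_congr rfl fun i _ => by rw [hc]; ring
    have hk : ∀ i, k i = 0 := by
      refine Fintype.linearIndependent_iff.mp α.linearIndependent k ?_
      rw [← mk_sum_algebraMap_mul D α ha, Ideal.Quotient.eq_zero_iff_mem]
      have : ∑ i, algebraMap ℂ FormalFn (k i) * a i =
          D.X₀.der F - D.hs * ∑ i, (c' i : FormalFn) * a i := by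
        linear_combination h - hsum
      rw [this]
      exact sub_mem (D.X₀_der_mem_J₀ F) (Ideal.mul_mem_right _ _ D.hs_mem_J₀)
    simp only [hk, map_zero, zero_mul, Finset.sum_const_zero, zero_add] at hsum hc
    obtain ⟨F', hF'⟩ := D.exists_X₀_der_eq_of_hs_mul (hsum.symm.trans h)
    intro i
    rw [hc, pow_succ']
    exact mul_dvd_mul_left _ (ih c' F' hF'.symm i)

/-- Representatives of a basis of `ℂ[[x, y]] / J₀` give a `ℂ[[h]]`-basis of `Coker(X₀)`. -/
theorem exists_basis_coker : ∃ β : Module.Basis ι D.Ch D.CokerX₀,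
    ∀ i, β i = Submodule.Quotient.mk (a i) := by
  have hmk : ∀ c : ι → D.Ch, ∑ i, c i • (Submodule.Quotient.mk (a i) : D.CokerX₀) =
      Submodule.Quotient.mk (∑ i, (c i : FormalFn) * a i) := by
    intro c
    exact (map_sum (LinearMap.range D.X₀Lin).mkQ (fun i => c i • a i) Finset.univ).symm
  refine ⟨Module.Basis.mk (v := fun i => (Submodule.Quotient.mk (a i) : D.CokerX₀)) ?_ ?_,
    fun i => Module.Basis.mk_apply _ _ i⟩
  · refine Fintype.linearIndependent_iff.mpr fun c hc => ?_
    rw [hmk, Submodule.Quotient.mk_eq_zero] at hc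
    obtain ⟨F, hF⟩ := hc
    exact congrFun (D.eq_zero_of_sum_mul_eq_X₀_der α ha c F hF.symm)
  · rintro q -
    obtain ⟨b, rfl⟩ := Submodule.Quotient.mk_surjective _ q
    obtain ⟨c, F, hb⟩ := D.exists_generation α ha b
    have : (Submodule.Quotient.mk b : D.CokerX₀) =
        ∑ i, c i • (Submodule.Quotient.mk (a i) : D.CokerX₀) := by
      rw [hmk, Submodule.Quotient.eq]
      exact ⟨F, by rw [hb, add_sub_cancel_left]; rfl⟩
    rw [this]
    exact Submodule.sum_mem _ fun i _ =>
      Submodule.smul_mem _ _ (Submodule.subset_span (Set.mem_range_self i))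

end Basis

end QHSingularity

/-! ### Logarithmic fields and logarithmic forms -/

theorem sharp_add (s : FormalFn) (X Y : FormalField) : sharp s (X + Y) = sharp s X + sharp s Y := by
  ext1 i
  fin_cases i <;> simp [sharp, add_div, add_comm]

theorem sharp_smul (s c : FormalFn) (X : FormalField) : sharp s (c • X) = c • sharp s X := by
  ext1 i
  rw [MeroForm.smul_apply]
  fin_cases i <;> simp [sharp, mul_div_assoc]

theorem smul_diff_sharp {s : FormalFn} (hs : s ≠ 0) (X : FormalField) :
    s • (sharp s X).diff = algebraMap FormalFn FormalMero
      (MvPowerSeries.pderiv ℂ 0 (X 0) + MvPowerSeries.pderiv ℂ 1 (X 1)) -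
      algebraMap FormalFn FormalMero (X.der s) / algebraMap FormalFn FormalMero s := by
  have hs' : algebraMap FormalFn FormalMero s ≠ 0 := by simpa using hs
  simp only [MeroForm.diff, sharp, Matrix.cons_val_zero, Matrix.cons_val_one,
    Matrix.cons_val_fin_one, map_neg, Derivation.leibniz_div, merD_algebraMap, smul_eq_mul,
    FormalField.der_apply, map_add, map_mul, Algebra.smul_def]
  field_simp
  ring

/-- `s X^♯` never has a pole, and `s d(X^♯)` is `div X - X(s) / s`. -/
theorem sharp_mem_logForms_iff {s : FormalFn} (hs : s ≠ 0) (X : FormalField) :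
    sharp s X ∈ logForms s ↔ X ∈ logFields s := by
  have hs' : algebraMap FormalFn FormalMero s ≠ 0 := by simpa using hs
  constructor
  · rintro ⟨-, u, hu⟩
    rw [smul_diff_sharp hs, eq_sub_iff_add_eq, ← eq_sub_iff_add_eq', ← map_sub,
      div_eq_iff hs', ← map_mul] at hu
    exact Dvd.intro_left _ (IsFractionRing.injective _ _ hu).symm
  · rintro ⟨c, hc⟩
    refine ⟨fun i => ?_, MvPowerSeries.pderiv ℂ 0 (X 0) + MvPowerSeries.pderiv ℂ 1 (X 1) - c, ?_⟩
    · fin_cases i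
      · exact ⟨-X 1, by simp [sharp, Algebra.smul_def, mul_div_cancel₀ _ hs']⟩
      · exact ⟨X 0, by simp [sharp, Algebra.smul_def, mul_div_cancel₀ _ hs']⟩
    · rw [smul_diff_sharp hs, hc, map_mul, mul_div_cancel_left₀ _ hs', ← map_sub]

theorem exists_sharp_eq {s : FormalFn} (hs : s ≠ 0) {ω : MeroForm} (hω : ω ∈ logForms s) :
    ∃ X ∈ logFields s, sharp s X = ω := by
  have hs' : algebraMap FormalFn FormalMero s ≠ 0 := by simpa using hs
  choose a ha using hω.1
  have h : sharp s ![a 1, -a 0] = ω := by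
    ext1 i
    fin_cases i <;> simp [sharp, ha, Algebra.smul_def, hs', neg_div]
  exact ⟨_, (sharp_mem_logForms_iff hs _).mp (h ▸ hω), h⟩

namespace QHSingularity

variable (D : QHSingularity)

theorem algebraMap_hs_ne_zero : algebraMap FormalFn FormalMero D.hs ≠ 0 := by
  simpa using D.hs_ne_zero

theorem algebraMap_inv_smul (f : FormalFn) :
    algebraMap FormalFn FormalMero ((D.δ : ℂ)⁻¹ • f) =
      (D.δ : FormalMero)⁻¹ * algebraMap FormalFn FormalMero f := by
  rw [Algebra.smul_def, map_mul, ← IsScalarTower.algebraMap_apply, map_inv₀, map_natCast]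

theorem sharp_X₀ : sharp D.hs D.X₀ = D.ω₀ := by
  ext1 i
  fin_cases i <;>
    simp [sharp, X₀, ω₀, merDiff, algebraMap_inv_smul, mul_div_assoc, neg_div]

theorem R_mem_logFields : D.R ∈ logFields D.hs :=
  Dvd.intro_left _ D.euler.symm

theorem X₀_mem_logFields : D.X₀ ∈ logFields D.hs := by
  change D.hs ∣ D.X₀.der D.hs
  rw [D.X₀_hs]
  exact dvd_zero _

/-- The logarithmic vector fields are generated by `X₀` and `R`. -/
theorem exists_eq_of_mem_logFields {X : FormalField} (hX : X ∈ logFields D.hs) :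
    ∃ a b : FormalFn, X = a • D.X₀ + b • D.R := by
  obtain ⟨c, hc⟩ := hX
  obtain ⟨b, rfl⟩ : ∃ b, c = (D.δ : FormalFn) * b := by
    refine ⟨(D.δ : ℂ)⁻¹ • c, ?_⟩
    rw [← nsmul_eq_mul, ← Nat.cast_smul_eq_nsmul ℂ, smul_smul,
      mul_inv_cancel₀ (Nat.cast_ne_zero.mpr D.δ_pos.ne'), one_smul]
  rw [FormalField.der_apply, pderiv_zero_hs, pderiv_one_hs] at hc
  -- `b` was chosen so that `X - b R` annihilates `h`; the syzygy lemma makes it a multiple of `X₀`.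
  obtain ⟨g, h1, h2⟩ := D.exists_eq_of_X₀_syzygy (u := X 1 - b * D.R 1) (v := -(X 0 - b * D.R 0))
    (mul_left_cancel₀ D.δ_ne_zero (by
      simp only [R]
      linear_combination hc + (D.δ : FormalFn) * b * D.hs_eq))
  refine ⟨g, b, ?_⟩
  ext1 i
  fin_cases i
  · change X 0 = g * D.X₀ 0 + b * D.R 0
    linear_combination -h2
  · change X 1 = g * D.X₀ 1 + b * D.R 1
    linear_combination h1

theorem sharp_smul_X₀_add (a b : FormalFn) :
    sharp D.hs (a • D.X₀ + b • D.R) = a • D.ω₀ + b • D.ωR := by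
  rw [sharp_add, sharp_smul, sharp_smul, sharp_X₀, ωR]

theorem wedge_ω₀_ωR : D.ω₀.wedge D.ωR = (algebraMap FormalFn FormalMero D.hs)⁻¹ := by
  have hh := D.algebraMap_hs_ne_zero
  have he := congrArg (algebraMap FormalFn FormalMero) D.hs_eq
  simp only [map_sub, map_mul, map_natCast] at he
  rw [← sharp_X₀, ωR]
  simp only [MeroForm.wedge, sharp, R, Matrix.cons_val_zero, Matrix.cons_val_one,
    Matrix.cons_val_fin_one, map_mul, map_natCast]
  field_simp
  linear_combination -he

/-- Wedging with `ω₀` reads off the coefficient of `ω_R`; this serves in place of linear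
independence of `ω₀` and `ω_R`. -/
theorem wedge_smul_add (a b : FormalFn) : D.ω₀.wedge (a • D.ω₀ + b • D.ωR) =
    algebraMap FormalFn FormalMero b * (algebraMap FormalFn FormalMero D.hs)⁻¹ := by
  rw [← wedge_ω₀_ωR]
  simp only [MeroForm.wedge, Pi.add_apply, MeroForm.smul_apply]
  ring

theorem Z1_eq : D.Z1 = (logForms D.hs).restrictScalars D.Ch := by
  refine le_antisymm (fun ω h => h.1) fun ω hω => ⟨hω, ?_⟩
  obtain ⟨X, hX, rfl⟩ := exists_sharp_eq D.hs_ne_zero hω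
  obtain ⟨c, hc⟩ := hX
  have hh := D.algebraMap_hs_ne_zero
  -- `dω = e / h` with `e` holomorphic, and `ω₀ ∧ ω_R = 1 / h`, so `η = e ω_R` works.
  let e := MvPowerSeries.pderiv ℂ 0 (X 0) + MvPowerSeries.pderiv ℂ 1 (X 1) - c
  refine ⟨e • D.ωR, Submodule.smul_mem _ _
    ((sharp_mem_logForms_iff D.hs_ne_zero _).mpr D.R_mem_logFields), ?_⟩
  have h := smul_diff_sharp D.hs_ne_zero X
  rw [hc, map_mul, mul_div_cancel_left₀ _ hh, ← map_sub, Algebra.smul_def] at h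
  have hw := D.wedge_smul_add 0 e
  rw [zero_smul, zero_add] at hw
  rw [hw, ← h, mul_comm, inv_mul_cancel_left₀ hh]

theorem sharp_mem_Z1 {X : FormalField} (hX : X ∈ logFields D.hs) : sharp D.hs X ∈ D.Z1 := by
  rw [Z1_eq]
  exact (sharp_mem_logForms_iff D.hs_ne_zero X).mpr hX

theorem smul_ωR_mem_Z1 (b : FormalFn) : b • D.ωR ∈ D.Z1 := by
  rw [ωR, ← sharp_smul]
  exact D.sharp_mem_Z1 (Submodule.smul_mem _ _ D.R_mem_logFields)

/-! ### Coboundaries, brackets with `X₀` and the two isomorphisms -/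

/-- The free term `g ω₀` absorbs the `ω₀`-component of `df`; only its `ω_R`-component `-X₀(f)` is a
constraint. -/
theorem smul_add_smul_mem_B1_iff (a b : FormalFn) :
    a • D.ω₀ + b • D.ωR ∈ D.B1 ↔ ∃ f, D.X₀.der f = b := by
  constructor
  · rintro ⟨f, g, h⟩
    rw [merDiff_eq] at h
    have h' : a • D.ω₀ + b • D.ωR = (D.R.der f + g) • D.ω₀ + (-D.X₀.der f) • D.ωR := by
      rw [h, add_smul, neg_smul]
      abel
    have hw := congrArg D.ω₀.wedge h'
    rw [wedge_smul_add, wedge_smul_add, mul_left_inj' (inv_ne_zero D.algebraMap_hs_ne_zero)] at hw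
    exact ⟨-f, by rw [map_neg]; exact (IsFractionRing.injective _ _ hw).symm⟩
  · rintro ⟨f, rfl⟩
    refine ⟨-f, a + D.R.der f, ?_⟩
    rw [merDiff_eq, map_neg, map_neg, add_smul, neg_smul, neg_smul]
    abel

theorem bracket_X₀_R : D.X₀.bracket D.R =
    ((D.p 0 : FormalFn) + (D.p 1 : FormalFn) - (D.δ : FormalFn)) • D.X₀ := by
  ext1 i
  fin_cases i
  · change D.X₀.der ((D.p 0 : FormalFn) * MvPowerSeries.X 0) - D.R.der (D.X₀ 0) = _ * D.X₀ 0
    rw [R_der_X₀_zero, FormalField.der_apply]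
    simp only [Derivation.leibniz, smul_eq_mul, Derivation.map_natCast,
      MvPowerSeries.pderiv_X_self, MvPowerSeries.pderiv_X_of_ne (show (0 : Fin 2) ≠ 1 by decide)]
    ring
  · change D.X₀.der ((D.p 1 : FormalFn) * MvPowerSeries.X 1) - D.R.der (D.X₀ 1) = _ * D.X₀ 1
    rw [R_der_X₀_one, FormalField.der_apply]
    simp only [Derivation.leibniz, smul_eq_mul, Derivation.map_natCast,
      MvPowerSeries.pderiv_X_self, MvPowerSeries.pderiv_X_of_ne (show (1 : Fin 2) ≠ 0 by decide)]
    ring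

theorem bracket_X₀_smul_add (a b : FormalFn) : D.X₀.bracket (a • D.X₀ + b • D.R) =
    (D.X₀.der a + b * ((D.p 0 : FormalFn) + (D.p 1 : FormalFn) - (D.δ : FormalFn))) • D.X₀ +
      D.X₀.der b • D.R := by
  ext1 i
  have h := congrFun D.bracket_X₀_R i
  simp only [FormalField.bracket, FormalField.der_apply, Pi.add_apply, Pi.smul_apply, smul_eq_mul,
    map_add, Derivation.leibniz] at h ⊢
  linear_combination b * h

theorem smul_add_smul_mem_A1_iff (a b : FormalFn) :
    a • D.X₀ + b • D.R ∈ D.A1 ↔ ∃ f, D.X₀.der f = b := by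
  constructor
  · rintro ⟨Z, hZ, c, h⟩
    obtain ⟨a', b', rfl⟩ := D.exists_eq_of_mem_logFields hZ
    rw [bracket_X₀_smul_add] at h
    refine ⟨b', ?_⟩
    -- Passing to forms allows the coefficients of `R` to be compared by wedging with `ω₀`.
    have h' := congrArg (sharp D.hs) (h.trans (add_right_comm _ _ _))
    rw [← add_smul, sharp_smul_X₀_add, sharp_smul_X₀_add] at h'
    have hw := congrArg D.ω₀.wedge h'
    rw [wedge_smul_add, wedge_smul_add, mul_left_inj' (inv_ne_zero D.algebraMap_hs_ne_zero)] at hw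
    exact (IsFractionRing.injective _ _ hw).symm
  · rintro ⟨f, rfl⟩
    refine ⟨(0 : FormalFn) • D.X₀ + f • D.R, add_mem (Submodule.smul_mem _ _ D.X₀_mem_logFields)
      (Submodule.smul_mem _ _ D.R_mem_logFields),
      a - f * ((D.p 0 : FormalFn) + (D.p 1 : FormalFn) - (D.δ : FormalFn)), ?_⟩
    rw [bracket_X₀_smul_add, map_zero, zero_add, sub_smul]
    abel

/-- The map `b ↦ [b ω_R]`. -/
noncomputable def smulωR : FormalFn →ₗ[D.Ch] D.H1 :=
  (Subquotient.mk D.Z1 D.B1).comp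
    (((LinearMap.toSpanSingleton FormalFn MeroForm D.ωR).restrictScalars D.Ch).codRestrict D.Z1
      D.smul_ωR_mem_Z1)

/-- The map `X ↦ X^♯`, from logarithmic vector fields to relative cocycles. -/
noncomputable def sharpZ1 : D.χlog →ₗ[D.Ch] D.Z1 where
  toFun X := ⟨sharp D.hs X.1, D.sharp_mem_Z1 X.2⟩
  map_add' X Y := Subtype.ext (sharp_add _ _ _)
  map_smul' c X := by
    refine Subtype.ext (funext fun i => ?_)
    have h := congrFun (sharp_smul D.hs c.1 X.1) i
    rw [MeroForm.smul_apply] at h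
    exact h.trans (D.Ch_smul_apply c (sharp D.hs X.1) i).symm

/-- The map `X ↦ [X^♯]`. -/
noncomputable def sharpClass : D.χlog →ₗ[D.Ch] D.H1 :=
  (Subquotient.mk D.Z1 D.B1).comp D.sharpZ1

theorem smulωR_surjective : Function.Surjective D.smulωR := by
  intro q
  obtain ⟨⟨ω, hω⟩, rfl⟩ := Subquotient.mk_surjective _ _ q
  obtain ⟨X, hX, rfl⟩ := exists_sharp_eq D.hs_ne_zero hω.1
  obtain ⟨a, b, rfl⟩ := D.exists_eq_of_mem_logFields hX
  refine ⟨b, ?_⟩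
  rw [← sub_eq_zero, smulωR, LinearMap.comp_apply, ← map_sub, Subquotient.mk_eq_zero_iff]
  change b • D.ωR - sharp D.hs (a • D.X₀ + b • D.R) ∈ D.B1
  have h := (D.smul_add_smul_mem_B1_iff (-a) 0).mpr ⟨0, map_zero _⟩
  rwa [zero_smul, add_zero, neg_smul, show -(a • D.ω₀) =
    b • D.ωR - sharp D.hs (a • D.X₀ + b • D.R) by rw [sharp_smul_X₀_add]; abel] at h

theorem ker_smulωR : LinearMap.ker D.smulωR = LinearMap.range D.X₀Lin := by
  ext b
  rw [LinearMap.mem_ker, smulωR, LinearMap.comp_apply, Subquotient.mk_eq_zero_iff]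
  change b • D.ωR ∈ D.B1 ↔ ∃ f, D.X₀.der f = b
  rw [← smul_add_smul_mem_B1_iff D 0 b, zero_smul, zero_add]

theorem sharpClass_surjective : Function.Surjective D.sharpClass := by
  intro q
  obtain ⟨⟨ω, hω⟩, rfl⟩ := Subquotient.mk_surjective _ _ q
  obtain ⟨X, hX, rfl⟩ := exists_sharp_eq D.hs_ne_zero hω.1
  exact ⟨⟨X, hX⟩, rfl⟩

theorem ker_sharpClass : LinearMap.ker D.sharpClass = D.A1.submoduleOf D.χlog := by
  ext ⟨X, hX⟩
  rw [LinearMap.mem_ker, sharpClass, LinearMap.comp_apply, Subquotient.mk_eq_zero_iff]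
  change sharp D.hs X ∈ D.B1 ↔ X ∈ D.A1
  obtain ⟨a, b, rfl⟩ := D.exists_eq_of_mem_logFields hX
  rw [sharp_smul_X₀_add, smul_add_smul_mem_B1_iff, smul_add_smul_mem_A1_iff]

/-- The isomorphism `Coker(X₀) ≃ Ĥ¹_DR(log S)`. -/
noncomputable def cokerEquiv : D.CokerX₀ ≃ₗ[D.Ch] D.H1 :=
  (Submodule.quotEquivOfEq _ _ D.ker_smulωR.symm).trans
    (D.smulωR.quotKerEquivOfSurjective D.smulωR_surjective)

/-- The isomorphism `G¹ ≃ Ĥ¹_DR(log S)`. -/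
noncomputable def G1Equiv : D.G1 ≃ₗ[D.Ch] D.H1 :=
  (Submodule.quotEquivOfEq _ _ D.ker_sharpClass.symm).trans
    (D.sharpClass.quotKerEquivOfSurjective D.sharpClass_surjective)

theorem cokerEquiv_mk (b : FormalFn) : D.cokerEquiv (Submodule.Quotient.mk b) =
    Subquotient.mk D.Z1 D.B1 ⟨b • D.ωR, D.smul_ωR_mem_Z1 b⟩ := rfl

theorem G1Equiv_mk (X : D.χlog) : D.G1Equiv (Subquotient.mk D.χlog D.A1 X) =
    Subquotient.mk D.Z1 D.B1 ⟨sharp D.hs X.1, D.sharp_mem_Z1 X.2⟩ := rfl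

theorem exists_basis_H1 {ι : Type*} [Fintype ι] {a : ι → FormalFn}
    (α : Module.Basis ι ℂ (FormalFn ⧸ D.J₀)) (ha : ∀ i, α i = Ideal.Quotient.mk D.J₀ (a i)) :
    ∃ β : Module.Basis ι D.Ch D.H1, ∀ i,
      β i = Subquotient.mk D.Z1 D.B1 ⟨a i • D.ωR, D.smul_ωR_mem_Z1 (a i)⟩ := by
  obtain ⟨β, hβ⟩ := D.exists_basis_coker α ha
  exact ⟨β.map D.cokerEquiv, fun i => by rw [Module.Basis.map_apply, hβ, cokerEquiv_mk]⟩

end QHSingularity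

theorem mainTheorem6 (D : QHSingularity) :
    D.Z1 = (logForms D.hs).restrictScalars D.Ch ∧
    (∃ e : D.G1 ≃ₗ[D.Ch] D.H1, ∀ X : D.χlog, ∃ hX : sharp D.hs X.1 ∈ D.Z1,
      e (Subquotient.mk D.χlog D.A1 X) = Subquotient.mk D.Z1 D.B1 ⟨sharp D.hs X.1, hX⟩) ∧
    (∃ e : D.CokerX₀ ≃ₗ[D.Ch] D.H1, ∀ b : FormalFn, ∃ hb : b • D.ωR ∈ D.Z1,
      e (Submodule.Quotient.mk b) = Subquotient.mk D.Z1 D.B1 ⟨b • D.ωR, hb⟩) ∧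
    Module.Finite ℂ (FormalFn ⧸ D.J₀) ∧
    Module.Free D.Ch D.H1 ∧ Module.Finite D.Ch D.H1 ∧ Module.finrank D.Ch D.H1 = D.μ ∧
    ∀ (a : Fin D.μ → FormalFn) (α : Module.Basis (Fin D.μ) ℂ (FormalFn ⧸ D.J₀)),
      (∀ i, α i = Ideal.Quotient.mk D.J₀ (a i)) →
      ∃ β : Module.Basis (Fin D.μ) D.Ch D.H1, ∀ i, ∃ hi : a i • D.ωR ∈ D.Z1,
        β i = Subquotient.mk D.Z1 D.B1 ⟨a i • D.ωR, hi⟩ := by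
  have hfin := D.finite_quotient_J₀
  let α : Module.Basis (Fin D.μ) ℂ (FormalFn ⧸ D.J₀) := Module.finBasis ℂ (FormalFn ⧸ D.J₀)
  choose a ha using fun i => Ideal.Quotient.mk_surjective (α i)
  obtain ⟨β, -⟩ := D.exists_basis_H1 α fun i => (ha i).symm
  refine ⟨D.Z1_eq, ⟨D.G1Equiv, fun X => ⟨_, D.G1Equiv_mk X⟩⟩,
    ⟨D.cokerEquiv, fun b => ⟨_, D.cokerEquiv_mk b⟩⟩, hfin, Module.Free.of_basis β,
    Module.Finite.of_basis β, by rw [Module.finrank_eq_card_basis β, Fintype.card_fin], ?_⟩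
  intro a α ha
  obtain ⟨β, hβ⟩ := D.exists_basis_H1 α ha
  exact ⟨β, fun i => ⟨_, hβ i⟩⟩
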